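/- Manifolds are finite-dimensional, Hausdorff, paracompact, without boundary and $C^\infty$; maps, functions and curves are $C^\infty$. Let $(E,[\![\cdot,\cdot]\!],\rho)$ be a Lie algebroid over a manifold $M$: a vector bundle $\tau:E\to M$ of finite rank with a real Lie bracket on $\Gamma(E)$ and a bundle map $\rho:E\to TM$ such that $[\![X,gY]\!]=g[\![X,Y]\!]+\rho(X)(g)Y$. Let $\tau^*:E^*\to M$ be the dual bundle. For $f=\tau:M'=E\to M$ or $f=\tau^*:M'=E^*\to M$ let $\mathcal L^fE\to M'$ be the prolongation of $E$ over $f$, the vector bundle with fibres $$(\mathcal L^fE)_{y}=\{(b,v)\in E_{f(y)}\times T_{y}M' : \rho(b)=T_yf(v)\},$$ with anchor $\rho^f(b,v)=v$ and the bracket of sections given, in terms of local expressions $(\sum_i h_i\,(X_i\circ f),X')$ and $(\sum_j s_j\,(Y_j\circ f),Y')$ with $h_i,s_j\in C^\infty(M')$, $X_i,Y_j\in\Gamma(E)$, $X',Y'\in\mathfrak X(M')$, by $$\Big(\sum_{i,j} h_is_j\,([\![X_i,Y_j]\!]\circ f)+\sum_j X'(s_j)\,(Y_j\circ f)-\sum_i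 Y'(h_i)\,(X_i\circ f),\ [X',Y']\Big).$$ Let $d$ be its differential: $dg(X)=\rho^f(X)(g)$ for functions $g$, and $d\theta(X,Y)=\rho^f(X)(\theta(Y))-\rho^f(Y)(\theta(X))-\theta([\![X,Y]\!]^f)$ for sections $\theta$ of $(\mathcal L^fE)^*$. Let $L:E\to\mathbb R$. For $a\in E$ and $b\in E_{\tau(a)}$ let $b^v_a=\frac{d}{dt}\big|_{t=0}(a+tb)\in T_aE$, and put $S(b,v)=(0,b^v_a)$ for $(b,v)\in(\mathcal L^\tau E)_a$ and $\Delta(a)=(0,a^v_a)$. Put $$\theta_L=dL\circ S,\qquad \omega_L=-d\theta_L,\qquad E_L=\rho^\tau(\Delta)(L)-L,$$ and let $Leg_L:E\to E^*$ be given by $Leg_L(a)(b)=\theta_L(a)(z)$ for any $z\in(\mathcal L^\tau E)_a$ with first component $b$. On $\mathcal L^{\tau^*}E$ let $\lambda_E(a^*)(b,v)=a^*(b)$ and $\Omega_E=-d\lambda_E$. A curve $\gamma:I\to E$ on an open interval $I\subseteq\mathbb R$ is a solution of the Euler–Lagrange equations for $L$ if, for all $t\in I$, $(\gamma(t),\dot\gamma(t))\in(\mathcal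 L^\tau E)_{\gamma(t)}$ and $i_{(\gamma(t),\dot\gamma(t))}\omega_L(\gamma(t))=dE_L(\gamma(t))$. For $H:E^*\to\mathbb R$, the Hamiltonian section $\xi_H\in\Gamma(\mathcal L^{\tau^*}E)$ is the solution of $i_{\xi_H}\Omega_E=dH$, and a curve $\mu:I\to E^*$ is a solution of the Hamilton equations for $H$ if it is an integral curve of the vector field $\rho^{\tau^*}(\xi_H)$. **Theorem.** Suppose that $L$ is hyperregular, that is, $Leg_L:E\to E^*$ is a diffeomorphism, and let $H=E_L\circ Leg_L^{-1}$. Then: 1. The equation $i_{\xi_L}\omega_L=dE_L$ has a unique solution $\xi_L\in\Gamma(\mathcal L^\tau E)$ (the Euler–Lagrange section), and the equation $i_{\xi_H}\Omega_E=dH$ has a unique solution $\xi_H\in\Gamma(\mathcal L^{\tau^*}E)$. 2. $\xi_H\circ Leg_L=\mathcal LLeg_L\circ\xi_L$, where $\mathcal LLeg_L(b,v)=(b,T_aLeg_L(v))$ for $(b,v)\in(\mathcal L^\tau E)_a$. 3. If $\gamma:I\to E$ is a solution of the Euler–Lagrange equations for $L$, then $Leg_L\circ\gamma$ is a solution of the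 Hamilton equations for $H$; conversely, if $\mu:I\to E^*$ is a solution of the Hamilton equations for $H$, then $Leg_L^{-1}\circ\mu$ is a solution of the Euler–Lagrange equations for $L$. So, for each open interval $I$, $\gamma\mapsto Leg_L\circ\gamma$ is a bijection from the solutions on $I$ of the Euler–Lagrange equations for $L$ onto the solutions on $I$ of the Hamilton equations for $H$. -/

import Mathlib

open Bundle Set Filter Topology
open scoped Manifold ContDiff

noncomputable section

namespace LieAlgebroidMechanics

/-- The derivative `v(g)` of a real function `g` along tangent vectors `v` at `y`. -/
def dirDeriv {E' : Type*} [NormedAddCommGroup E'] [NormedSpace ℝ E']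
    {H' : Type*} [TopologicalSpace H'] (I' : ModelWithCorners ℝ E' H')
    {M' : Type*} [TopologicalSpace M'] [ChartedSpace H' M'] (g : M' → ℝ) (y : M') :
    TangentSpace I' y →ₗ[ℝ] ℝ :=
  (mfderiv I' 𝓘(ℝ, ℝ) g y).toLinearMap

section Base

variable {EM : Type*} [NormedAddCommGroup EM] [NormedSpace ℝ EM]
  {HM : Type*} [TopologicalSpace HM] (I : ModelWithCorners ℝ EM HM)
  {M : Type*} [TopologicalSpace M] [ChartedSpace HM M] [IsManifold I ∞ M]
  (F : Type*) [NormedAddCommGroup F] [NormedSpace ℝ F]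
  (V : M → Type*) [TopologicalSpace (TotalSpace F V)]
  [∀ x, AddCommGroup (V x)] [∀ x, Module ℝ (V x)] [∀ x, TopologicalSpace (V x)]
  [FiberBundle F V] [VectorBundle ℝ F V]

variable {I F V} in
/-- The product `g X` of a smooth function `g` and a smooth section `X`. -/
def smulSection (g : C^∞⟮I, M; 𝓘(ℝ, ℝ), ℝ⟯) (X : Cₛ^∞⟮I; F, V⟯) : Cₛ^∞⟮I; F, V⟯ where
  toFun x := g x • X x
  contMDiff_toFun := g.contMDiff.smul_section X.contMDiff

/-- A Lie algebroid structure on the smooth vector bundle `V → M` with typical fibre `F`: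
a Lie bracket on the real vector space of smooth global sections, and a smooth bundle map
`V → TM` (the anchor), related by the Leibniz rule. -/
structure LieAlgebroid where
  bracket : Cₛ^∞⟮I; F, V⟯ →ₗ[ℝ] Cₛ^∞⟮I; F, V⟯ →ₗ[ℝ] Cₛ^∞⟮I; F, V⟯
  bracket_self : ∀ X, bracket X X = 0
  jacobi : ∀ X Y Z,
    bracket X (bracket Y Z) + bracket Y (bracket Z X) + bracket Z (bracket X Y) = 0
  anchor : ∀ x : M, V x →L[ℝ] TangentSpace I x
  contMDiff_anchor : ContMDiff (I.prod 𝓘(ℝ, F)) I.tangent ∞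
    (fun a : TotalSpace F V => (⟨a.proj, anchor a.proj a.snd⟩ : TangentBundle I M))
  leibniz : ∀ (X Y : Cₛ^∞⟮I; F, V⟯) (g : C^∞⟮I, M; 𝓘(ℝ, ℝ), ℝ⟯) (x : M),
    bracket X (smulSection g Y) x =
      g x • bracket X Y x + dirDeriv I g x (anchor x (X x)) • Y x

end Base

/-! ### The prolongation of a Lie algebroid over a map `f : M' → M` -/

section Prolongation

variable {EM : Type*} [NormedAddCommGroup EM] [NormedSpace ℝ EM]
  {HM : Type*} [TopologicalSpace HM] {I : ModelWithCorners ℝ EM HM}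
  {M : Type*} [TopologicalSpace M] [ChartedSpace HM M] [IsManifold I ∞ M]
  {F : Type*} [NormedAddCommGroup F] [NormedSpace ℝ F]
  {V : M → Type*} [TopologicalSpace (TotalSpace F V)]
  [∀ x, AddCommGroup (V x)] [∀ x, Module ℝ (V x)] [∀ x, TopologicalSpace (V x)]
  [FiberBundle F V] [VectorBundle ℝ F V]
  {E' : Type*} [NormedAddCommGroup E'] [NormedSpace ℝ E']
  {H' : Type*} [TopologicalSpace H'] {I' : ModelWithCorners ℝ E' H'}
  {M' : Type*} [TopologicalSpace M'] [ChartedSpace H' M']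

variable (I') in
/-- The fibre over `y : M'` of the prolongation of `A` over `f`: pairs `(b, v)` with `b` in the
fibre of the algebroid over `f y`, `v` tangent to `M'` at `y`, and `ρ(b) = Tf(v)`. -/
def ProlFiber (A : LieAlgebroid I F V) (f : M' → M) (y : M') :
    Submodule ℝ (V (f y) × TangentSpace I' y) :=
  LinearMap.eqLocus
    ((A.anchor (f y)).toLinearMap ∘ₗ LinearMap.fst ℝ (V (f y)) (TangentSpace I' y))
    ((mfderiv I' I f y).toLinearMap ∘ₗ LinearMap.snd ℝ (V (f y)) (TangentSpace I' y))

/-- The differential of a function `g` on `M'`, as a section of the dual of the prolongation: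
`(dg)(b, v) = ρ^f(b, v)(g) = v(g)`. -/
def dFun (A : LieAlgebroid I F V) (f : M' → M) (g : M' → ℝ) (y : M') :
    ProlFiber I' A f y →ₗ[ℝ] ℝ :=
  dirDeriv I' g y ∘ₗ LinearMap.snd ℝ (V (f y)) (TangentSpace I' y) ∘ₗ
    (ProlFiber I' A f y).subtype

variable [IsManifold I' ∞ M']

variable (I') in
/-- Smooth sections of the prolongation over `f`: pairs of a smooth section of the pullback
bundle `f^* V` and a smooth vector field on `M'`, with value in the fibre at each point. -/
structure ProlSection (A : LieAlgebroid I F V) (f : M' → M) where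
  fst : ∀ y, V (f y)
  snd : ∀ y : M', TangentSpace I' y
  contMDiff_fst : ContMDiff I' (I.prod 𝓘(ℝ, F)) ∞
    (fun y => (⟨f y, fst y⟩ : TotalSpace F V))
  contMDiff_snd : ContMDiff I' I'.tangent ∞
    (fun y => (⟨y, snd y⟩ : TangentBundle I' M'))
  mem : ∀ y, (fst y, snd y) ∈ ProlFiber I' A f y

/-- The value of a section at a point. -/
def ProlSection.val {A : LieAlgebroid I F V} {f : M' → M} (X : ProlSection I' A f) (y : M') :
    ProlFiber I' A f y :=
  ⟨(X.fst y, X.snd y), X.mem y⟩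

/-- `IsLocalRep f σ y h X`: near `y`, the section `σ` of the pullback bundle `f^* V` equals
`∑ i, h i • (X i ∘ f)`, with smooth functions `h i` on `M'` and smooth sections `X i` of `V`. -/
def IsLocalRep (f : M' → M) (σ : ∀ y, V (f y)) (y : M') {k : ℕ}
    (h : Fin k → C^∞⟮I', M'; 𝓘(ℝ, ℝ), ℝ⟯) (X : Fin k → Cₛ^∞⟮I; F, V⟯) : Prop :=
  ∀ᶠ z in 𝓝 y, σ z = ∑ i, h i z • X i (f z)

/-- `Z` is the bracket of the sections `X = (σ, X')` and `Y = (η, Y')` of the prolongation: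
its vector field is `[X', Y']`, and, whenever `σ = ∑ hᵢ (Aᵢ ∘ f)` and `η = ∑ sⱼ (Bⱼ ∘ f)` near a
point, its first component there is
`∑ hᵢ sⱼ (⟦Aᵢ, Bⱼ⟧ ∘ f) + ∑ X'(sⱼ) (Bⱼ ∘ f) - ∑ Y'(hᵢ) (Aᵢ ∘ f)`. -/
def IsProlBracket {A : LieAlgebroid I F V} {f : M' → M} (X Y Z : ProlSection I' A f) : Prop :=
  (∀ y, Z.snd y = VectorField.mlieBracket I' X.snd Y.snd y) ∧
  ∀ (y : M') (k l : ℕ)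
    (h : Fin k → C^∞⟮I', M'; 𝓘(ℝ, ℝ), ℝ⟯) (S : Fin k → Cₛ^∞⟮I; F, V⟯)
    (s : Fin l → C^∞⟮I', M'; 𝓘(ℝ, ℝ), ℝ⟯) (T : Fin l → Cₛ^∞⟮I; F, V⟯),
    IsLocalRep f X.fst y h S → IsLocalRep f Y.fst y s T →
    Z.fst y = (∑ i, ∑ j, (h i y * s j y) • A.bracket (S i) (T j) (f y))
      + (∑ j, dirDeriv I' (s j) y (X.snd y) • T j (f y))
      - ∑ i, dirDeriv I' (h i) y (Y.snd y) • S i (f y)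

/-- The Lie bracket `⟦X, Y⟧^f` of sections of the prolongation: the section determined by
`IsProlBracket`. -/
def prolBracket {A : LieAlgebroid I F V} {f : M' → M} (X Y : ProlSection I' A f) :
    ProlSection I' A f :=
  haveI : Nonempty (ProlSection I' A f) := ⟨X⟩
  Classical.epsilon fun Z => IsProlBracket X Y Z

/-- `β` is the differential of the section `θ` of the dual of the prolongation:
`β(X, Y) = ρ^f(X)(θ(Y)) - ρ^f(Y)(θ(X)) - θ(⟦X, Y⟧^f)` for all sections `X`, `Y`. -/
def IsDifferential {A : LieAlgebroid I F V} {f : M' → M}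
    (θ : ∀ y, ProlFiber I' A f y →ₗ[ℝ] ℝ)
    (β : ∀ y, ProlFiber I' A f y →ₗ[ℝ] ProlFiber I' A f y →ₗ[ℝ] ℝ) : Prop :=
  ∀ (X Y : ProlSection I' A f) (y : M'),
    β y (X.val y) (Y.val y) =
      dirDeriv I' (fun z => θ z (Y.val z)) y (X.snd y)
        - dirDeriv I' (fun z => θ z (X.val z)) y (Y.snd y)
        - θ y ((prolBracket X Y).val y)

/-- The differential of a smooth section `θ` of the dual of the prolongation: the bilinear form on
the fibres determined by `IsDifferential`. -/
def dOne {A : LieAlgebroid I F V} {f : M' → M} (θ : ∀ y, ProlFiber I' A f y →ₗ[ℝ] ℝ) :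
    ∀ y, ProlFiber I' A f y →ₗ[ℝ] ProlFiber I' A f y →ₗ[ℝ] ℝ :=
  Classical.epsilon fun β => IsDifferential θ β

end Prolongation

/-! ### Lagrangian and Hamiltonian mechanics -/

section Mechanics

variable {EM : Type*} [NormedAddCommGroup EM] [NormedSpace ℝ EM]
  {HM : Type*} [TopologicalSpace HM] {I : ModelWithCorners ℝ EM HM}
  {M : Type*} [TopologicalSpace M] [ChartedSpace HM M] [IsManifold I ∞ M]
  {F : Type*} [NormedAddCommGroup F] [NormedSpace ℝ F]
  {V : M → Type*} [TopologicalSpace (TotalSpace F V)]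
  [∀ x, AddCommGroup (V x)] [∀ x, Module ℝ (V x)] [∀ x, TopologicalSpace (V x)]
  [FiberBundle F V] [VectorBundle ℝ F V]

variable (I) in
/-- The vertical lift `b ↦ b_a^v` at `a`, from the fibre through `a` to the tangent space of the
total space at `a`. Mathlib identifies the latter with `EM × F` through the preferred chart at `a`,
in which the fibre coordinate is given by the preferred trivialization. By
`hasMFDerivAt_vertLift` below, `b_a^v` is the velocity at `0` of `t ↦ a + t b`. -/
def vertLift (a : TotalSpace F V) : V a.proj →L[ℝ] TangentSpace (I.prod 𝓘(ℝ, F)) a :=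
  ((ContinuousLinearMap.inr ℝ EM F).comp
    ((trivializationAt F V a.proj).continuousLinearMapAt ℝ a.proj) : V a.proj →L[ℝ] EM × F)

theorem hasMFDerivAt_vertLift (a : TotalSpace F V) (b : V a.proj) :
    HasMFDerivAt 𝓘(ℝ, ℝ) (I.prod 𝓘(ℝ, F))
      (fun t : ℝ => (⟨a.proj, a.snd + t • b⟩ : TotalSpace F V)) 0
      ((ContinuousLinearMap.id ℝ ℝ).smulRight (vertLift I a b)) := by
  have hmem := mem_baseSet_trivializationAt F V a.proj
  set e := trivializationAt F V a.proj with he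
  have hval : ∀ t : ℝ, e (⟨a.proj, a.snd + t • b⟩ : TotalSpace F V) =
      (a.proj, e.continuousLinearMapAt ℝ a.proj a.snd
        + t • e.continuousLinearMapAt ℝ a.proj b) := by
    intro t
    rw [← map_smul, ← map_add]
    ext
    · exact e.coe_fst' hmem
    · simp [Trivialization.coe_linearMapAt_of_mem _ hmem]
  constructor
  · rw [FiberBundle.continuousAt_totalSpace]
    refine ⟨continuousAt_const, ?_⟩
    show ContinuousAt (fun t : ℝ => (e (⟨a.proj, a.snd + t • b⟩ : TotalSpace F V)).2) 0
    simp only [hval]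
    fun_prop
  · have hw : writtenInExtChartAt 𝓘(ℝ, ℝ) (I.prod 𝓘(ℝ, F)) (0 : ℝ)
        (fun t : ℝ => (⟨a.proj, a.snd + t • b⟩ : TotalSpace F V)) =
        fun t : ℝ => (extChartAt I a.proj a.proj, e.continuousLinearMapAt ℝ a.proj a.snd
        + t • e.continuousLinearMapAt ℝ a.proj b) := by
      funext t
      simp only [writtenInExtChartAt, FiberBundle.extChartAt, extChartAt_model_space_eq_id]
      show ((extChartAt I a.proj).prod (PartialEquiv.refl F))
        (e (⟨a.proj, a.snd + t • b⟩ : TotalSpace F V)) = _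
      rw [hval]
      rfl
    rw [hw]
    apply HasFDerivAt.hasFDerivWithinAt
    have h2 : HasFDerivAt (fun t : ℝ => e.continuousLinearMapAt ℝ a.proj a.snd
        + t • e.continuousLinearMapAt ℝ a.proj b)
        ((ContinuousLinearMap.id ℝ ℝ).smulRight (e.continuousLinearMapAt ℝ a.proj b))
        (extChartAt 𝓘(ℝ, ℝ) (0 : ℝ) 0) :=
      ((hasFDerivAt_id _).smul_const _).const_add _
    have h3 := (hasFDerivAt_const (𝕜 := ℝ) (extChartAt I a.proj a.proj)
      (extChartAt 𝓘(ℝ, ℝ) (0 : ℝ) 0)).prodMk h2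
    refine h3.congr_fderiv ?_
    ext
    · exact (smul_zero (1 : ℝ)).symm
    · rfl

theorem mfderiv_proj_vertLift (a : TotalSpace F V) (b : V a.proj) :
    mfderiv (I.prod 𝓘(ℝ, F)) I (TotalSpace.proj : TotalSpace F V → M) a (vertLift I a b) = 0 := by
  have h := hasMFDerivAt_vertLift (I := I) a b
  have ha : (⟨a.proj, a.snd + (0 : ℝ) • b⟩ : TotalSpace F V) = a := by simp
  have hp : MDifferentiableAt (I.prod 𝓘(ℝ, F)) I (TotalSpace.proj : TotalSpace F V → M) a :=
    (Bundle.contMDiff_proj (n := 1) V).mdifferentiable one_ne_zero a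
  have h1 : HasMFDerivAt 𝓘(ℝ, ℝ) I (fun _ : ℝ => a.proj) 0
      ((mfderiv (I.prod 𝓘(ℝ, F)) I (TotalSpace.proj : TotalSpace F V → M) a).comp
        ((ContinuousLinearMap.id ℝ ℝ).smulRight (vertLift I a b))) := by
    refine HasMFDerivAt.comp (x := (0 : ℝ)) (g := (TotalSpace.proj : TotalSpace F V → M))
      (f := fun t : ℝ => (⟨a.proj, a.snd + t • b⟩ : TotalSpace F V)) ?_ h
    have key : ∀ c : TotalSpace F V, c = a →
        HasMFDerivAt (I.prod 𝓘(ℝ, F)) I (TotalSpace.proj : TotalSpace F V → M) c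
          (mfderiv (I.prod 𝓘(ℝ, F)) I (TotalSpace.proj : TotalSpace F V → M) a :
            EM × F →L[ℝ] EM) := by
      rintro c rfl
      exact hp.hasMFDerivAt
    exact key _ ha
  have h2 := hasMFDerivAt_unique h1 (hasMFDerivAt_const a.proj 0)
  have h3 : mfderiv (I.prod 𝓘(ℝ, F)) I (TotalSpace.proj : TotalSpace F V → M) a
      ((1 : ℝ) • vertLift I a b) = 0 := DFunLike.congr_fun h2 (1 : ℝ)
  rwa [one_smul] at h3

/-! #### The Lagrangian side: the prolongation of `A` over the projection of `V` -/

/-- The vertical endomorphism `S(b, v) = (0, b_a^v)` of the prolongation over the projection. -/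
def vertEndo (A : LieAlgebroid I F V) (a : TotalSpace F V) :
    ProlFiber (I.prod 𝓘(ℝ, F)) A TotalSpace.proj a →ₗ[ℝ]
      ProlFiber (I.prod 𝓘(ℝ, F)) A TotalSpace.proj a :=
  LinearMap.codRestrict _
    (LinearMap.inr ℝ (V a.proj) (TangentSpace (I.prod 𝓘(ℝ, F)) a) ∘ₗ
      (vertLift I a).toLinearMap ∘ₗ
      LinearMap.fst ℝ (V a.proj) (TangentSpace (I.prod 𝓘(ℝ, F)) a) ∘ₗ
      (ProlFiber (I.prod 𝓘(ℝ, F)) A TotalSpace.proj a).subtype)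
    (fun z => (map_zero (A.anchor a.proj)).trans (mfderiv_proj_vertLift a z.1.1).symm)

/-- The Euler section `Δ(a) = (0, a_a^v)`. -/
def eulerSection (A : LieAlgebroid I F V) (a : TotalSpace F V) :
    ProlFiber (I.prod 𝓘(ℝ, F)) A TotalSpace.proj a :=
  ⟨(0, vertLift I a a.snd), (map_zero (A.anchor a.proj)).trans (mfderiv_proj_vertLift a a.snd).symm⟩

/-- The Poincaré–Cartan 1-section `θ_L = dL ∘ S`. -/
def poincareCartanOne (A : LieAlgebroid I F V) (L : TotalSpace F V → ℝ) (a : TotalSpace F V) :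
    ProlFiber (I.prod 𝓘(ℝ, F)) A TotalSpace.proj a →ₗ[ℝ] ℝ :=
  dFun A TotalSpace.proj L a ∘ₗ vertEndo A a

/-- The energy `E_L = ρ^τ(Δ)(L) - L`. -/
def energy (A : LieAlgebroid I F V) (L : TotalSpace F V → ℝ) (a : TotalSpace F V) : ℝ :=
  dFun A TotalSpace.proj L a (eulerSection A a) - L a

variable (I) in
/-- The Legendre transformation `Leg_L : V → V^*`. -/
def legendre (L : TotalSpace F V → ℝ) (a : TotalSpace F V) :
    TotalSpace (F →L[ℝ] ℝ) (fun x => V x →L[ℝ] ℝ) :=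
  ⟨a.proj, (mfderiv (I.prod 𝓘(ℝ, F)) 𝓘(ℝ, ℝ) L a).comp (vertLift I a)⟩

/-- `Leg_L(a)(b) = θ_L(a)(z)` for every `z` in the fibre of the prolongation over `a` with first
component `b`. -/
theorem legendre_apply (A : LieAlgebroid I F V) (L : TotalSpace F V → ℝ) (a : TotalSpace F V)
    (z : ProlFiber (I.prod 𝓘(ℝ, F)) A TotalSpace.proj a) :
    (legendre I L a).snd z.1.1 = poincareCartanOne A L a z := rfl

variable [ContMDiffVectorBundle ∞ F V I]

/-- The Poincaré–Cartan 2-section `ω_L = -dθ_L`. -/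
def poincareCartanTwo (A : LieAlgebroid I F V) (L : TotalSpace F V → ℝ) (a : TotalSpace F V) :
    ProlFiber (I.prod 𝓘(ℝ, F)) A TotalSpace.proj a →ₗ[ℝ]
      ProlFiber (I.prod 𝓘(ℝ, F)) A TotalSpace.proj a →ₗ[ℝ] ℝ :=
  -dOne (poincareCartanOne A L) a

/-- `ξ` solves `i_ξ ω_L = dE_L`. For regular `L` the unique solution is the Euler–Lagrange
section. -/
def IsEulerLagrangeSection (A : LieAlgebroid I F V) (L : TotalSpace F V → ℝ)
    (ξ : ProlSection (I.prod 𝓘(ℝ, F)) A (TotalSpace.proj : TotalSpace F V → M)) : Prop :=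
  ∀ a, poincareCartanTwo A L a (ξ.val a) = dFun A TotalSpace.proj (energy A L) a

/-- The smooth curve `γ`, defined on the open set `s` of times, solves the Euler–Lagrange
equations: `(γ(t), γ'(t))` belongs to the prolongation (admissibility), and
`i_{(γ(t), γ'(t))} ω_L(γ(t)) = dE_L(γ(t))`, for all `t` in `s`. -/
def IsEulerLagrangeSolution (A : LieAlgebroid I F V) (L : TotalSpace F V → ℝ)
    (γ : ℝ → TotalSpace F V) (s : Set ℝ) : Prop :=
  ContMDiffOn 𝓘(ℝ, ℝ) (I.prod 𝓘(ℝ, F)) ∞ γ s ∧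
  ∀ t ∈ s, ∃ hz : ((γ t).snd, mfderiv 𝓘(ℝ, ℝ) (I.prod 𝓘(ℝ, F)) γ t (1 : ℝ)) ∈
      ProlFiber (I.prod 𝓘(ℝ, F)) A TotalSpace.proj (γ t),
    poincareCartanTwo A L (γ t) ⟨_, hz⟩ = dFun A TotalSpace.proj (energy A L) (γ t)

/-! #### The Hamiltonian side: the prolongation of `A` over the projection of the dual of `V` -/

/-- The Liouville section `λ(p)(b, v) = p(b)`. -/
def liouville (A : LieAlgebroid I F V)
    (p : TotalSpace (F →L[ℝ] ℝ) (fun x => V x →L[ℝ] ℝ)) :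
    ProlFiber (I.prod 𝓘(ℝ, F →L[ℝ] ℝ)) A TotalSpace.proj p →ₗ[ℝ] ℝ :=
  p.snd.toLinearMap ∘ₗ
    LinearMap.fst ℝ (V p.proj) (TangentSpace (I.prod 𝓘(ℝ, F →L[ℝ] ℝ)) p) ∘ₗ
    (ProlFiber (I.prod 𝓘(ℝ, F →L[ℝ] ℝ)) A TotalSpace.proj p).subtype

/-- The canonical symplectic section `Ω = -dλ`. -/
def canonicalSymplectic (A : LieAlgebroid I F V)
    (p : TotalSpace (F →L[ℝ] ℝ) (fun x => V x →L[ℝ] ℝ)) :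
    ProlFiber (I.prod 𝓘(ℝ, F →L[ℝ] ℝ)) A TotalSpace.proj p →ₗ[ℝ]
      ProlFiber (I.prod 𝓘(ℝ, F →L[ℝ] ℝ)) A TotalSpace.proj p →ₗ[ℝ] ℝ :=
  -dOne (liouville A) p

/-- `ξ` is the Hamiltonian section of `H`, the solution of `i_ξ Ω = dH`. -/
def IsHamiltonianSection (A : LieAlgebroid I F V)
    (H : TotalSpace (F →L[ℝ] ℝ) (fun x => V x →L[ℝ] ℝ) → ℝ)
    (ξ : ProlSection (I.prod 𝓘(ℝ, F →L[ℝ] ℝ)) A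
      (TotalSpace.proj : TotalSpace (F →L[ℝ] ℝ) (fun x => V x →L[ℝ] ℝ) → M)) : Prop :=
  ∀ p, canonicalSymplectic A p (ξ.val p) = dFun A TotalSpace.proj H p

/-- The smooth curve `μ`, defined on the open set `s` of times, solves the Hamilton equations for
`H`: it is an integral curve of the vector field `ρ(ξ_H)`, where `ξ_H` is the Hamiltonian
section of `H`. -/
def IsHamiltonSolution (A : LieAlgebroid I F V)
    (H : TotalSpace (F →L[ℝ] ℝ) (fun x => V x →L[ℝ] ℝ) → ℝ)
    (μ : ℝ → TotalSpace (F →L[ℝ] ℝ) (fun x => V x →L[ℝ] ℝ)) (s : Set ℝ) : Prop :=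
  ContMDiffOn 𝓘(ℝ, ℝ) (I.prod 𝓘(ℝ, F →L[ℝ] ℝ)) ∞ μ s ∧
  ∃ ξ : ProlSection (I.prod 𝓘(ℝ, F →L[ℝ] ℝ)) A
      (TotalSpace.proj : TotalSpace (F →L[ℝ] ℝ) (fun x => V x →L[ℝ] ℝ) → M),
    IsHamiltonianSection A H ξ ∧
    ∀ t ∈ s, mfderiv 𝓘(ℝ, ℝ) (I.prod 𝓘(ℝ, F →L[ℝ] ℝ)) μ t (1 : ℝ) = ξ.snd (μ t)

/-! #### Hyperregular Lagrangians -/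

variable (I) in
/-- `L` is hyperregular: `Leg_L` is a global diffeomorphism. -/
def IsHyperregular (L : TotalSpace F V → ℝ) : Prop :=
  ∃ Φ : Diffeomorph (I.prod 𝓘(ℝ, F)) (I.prod 𝓘(ℝ, F →L[ℝ] ℝ)) (TotalSpace F V)
      (TotalSpace (F →L[ℝ] ℝ) (fun x => V x →L[ℝ] ℝ)) ∞, ⇑Φ = legendre I L

/-- The Legendre transformation of a hyperregular Lagrangian, as a diffeomorphism. -/
def IsHyperregular.diffeo {L : TotalSpace F V → ℝ} (hL : IsHyperregular I L) :
    Diffeomorph (I.prod 𝓘(ℝ, F)) (I.prod 𝓘(ℝ, F →L[ℝ] ℝ)) (TotalSpace F V)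
      (TotalSpace (F →L[ℝ] ℝ) (fun x => V x →L[ℝ] ℝ)) ∞ :=
  hL.choose

theorem IsHyperregular.coe_diffeo {L : TotalSpace F V → ℝ} (hL : IsHyperregular I L) :
    ⇑hL.diffeo = legendre I L := hL.choose_spec

theorem IsHyperregular.mdifferentiable {L : TotalSpace F V → ℝ} (hL : IsHyperregular I L) :
    MDifferentiable (I.prod 𝓘(ℝ, F)) (I.prod 𝓘(ℝ, F →L[ℝ] ℝ)) (legendre I L) :=
  hL.coe_diffeo ▸ hL.diffeo.contMDiff.mdifferentiable (by simp)

/-- The Hamiltonian `H = E_L ∘ Leg_L⁻¹` of a hyperregular Lagrangian. -/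
def hamiltonian (A : LieAlgebroid I F V) {L : TotalSpace F V → ℝ} (hL : IsHyperregular I L) :
    TotalSpace (F →L[ℝ] ℝ) (fun x => V x →L[ℝ] ℝ) → ℝ :=
  energy A L ∘ hL.diffeo.symm

/-- `T(Leg_L)` covers the identity of `TM`, that is, `Tτ^* ∘ T(Leg_L) = Tτ`. -/
theorem mfderiv_proj_legendre {L : TotalSpace F V → ℝ} {a : TotalSpace F V}
    (hd : MDifferentiableAt (I.prod 𝓘(ℝ, F)) (I.prod 𝓘(ℝ, F →L[ℝ] ℝ)) (legendre I L) a)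
    (v : TangentSpace (I.prod 𝓘(ℝ, F)) a) :
    mfderiv (I.prod 𝓘(ℝ, F →L[ℝ] ℝ)) I
        (TotalSpace.proj : TotalSpace (F →L[ℝ] ℝ) (fun x => V x →L[ℝ] ℝ) → M) (legendre I L a)
        (mfderiv (I.prod 𝓘(ℝ, F)) (I.prod 𝓘(ℝ, F →L[ℝ] ℝ)) (legendre I L) a v) =
      mfderiv (I.prod 𝓘(ℝ, F)) I (TotalSpace.proj : TotalSpace F V → M) a v := by
  have hp : MDifferentiableAt (I.prod 𝓘(ℝ, F →L[ℝ] ℝ)) I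
      (TotalSpace.proj : TotalSpace (F →L[ℝ] ℝ) (fun x => V x →L[ℝ] ℝ) → M)
      (legendre I L a) :=
    (Bundle.contMDiff_proj (n := 1) (fun x => V x →L[ℝ] ℝ)).mdifferentiable one_ne_zero _
  have h := mfderiv_comp a hp hd
  exact (DFunLike.congr_fun h v).symm

/-- The map `𝓛Leg_L(b, v) = (b, T(Leg_L)(v))` between the fibres of the two prolongations. -/
def prolLegendre (A : LieAlgebroid I F V) {L : TotalSpace F V → ℝ}
    (hd : MDifferentiable (I.prod 𝓘(ℝ, F)) (I.prod 𝓘(ℝ, F →L[ℝ] ℝ)) (legendre I L))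
    (a : TotalSpace F V) (z : ProlFiber (I.prod 𝓘(ℝ, F)) A TotalSpace.proj a) :
    ProlFiber (I.prod 𝓘(ℝ, F →L[ℝ] ℝ)) A TotalSpace.proj (legendre I L a) :=
  ⟨(z.1.1, mfderiv (I.prod 𝓘(ℝ, F)) (I.prod 𝓘(ℝ, F →L[ℝ] ℝ)) (legendre I L) a z.1.2),
    z.2.trans (mfderiv_proj_legendre (hd a) z.1.2).symm⟩

end Mechanics
end LieAlgebroidMechanics
end

/-!
# Lagrangian and Hamiltonian mechanics on Lie algebroids: the hyperregular case

The Legendre transformation `Leg_L` covers the identity of `M`, so a diffeomorphism `Leg_L` induces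
isomorphisms `𝓛Leg_L(b, v) = (b, T Leg_L(v))` of the fibres of the two prolongations, and these
intertwine the two sides: `Leg_L` pulls `Ω` back to `ω_L` (`canonicalSymplectic_prolLegendre`) and
`dH` back to `dE_L` (`dFun_prolLegendre`). Hence `i_z ω_L = dE_L` at `a` if and only if
`i_{𝓛Leg_L z} Ω = dH` at `Leg_L(a)` (`poincareCartanTwo_eq_iff`), and everything follows from the
Hamiltonian side once two facts are known.

* `Ω` is nondegenerate (`eq_zero_of_canonicalSymplectic_eq_zero`). Thus both equations have exactly
  one solution at each point, and by Cramer's rule in a local frame the solution is a smooth section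
  (`existsUnique_prolSection`).
* A solution `z` of `i_z ω_L = dE_L` at `a` has first component `a`
  (`fst_eq_of_poincareCartanTwo_eq`). So integral curves of the vector field of `ξ_L` are
  admissible, and they are the solutions of the Euler–Lagrange equations.

Both `θ_L` and the Liouville section are semibasic: they have the form `(b, v) ↦ ψ(b)`, with
`ψ = Leg_L` and with the tautological `ψ`. The differential of such a section at a point is
`((b, v), (c, w)) ↦ v(ψ(C ∘ f)) - w(ψ(B ∘ f)) - ψ(⟦B, C⟧ ∘ f)`, where `B` and `C` extend `b` and `c`
by constant coefficients in a frame (`dOne_semibasic`). The pullback statement is then the chain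
rule, and nondegeneracy and the second order property are read off by inserting vertical lifts.

The bracket of the prolongation and the differential are given in the statement by the properties
that characterize them, so their existence has to be established. The local formula for the bracket
does not depend on the local expressions, because the bracket of the algebroid is a local operator
and satisfies the Leibniz rule (`repBracket_congr`). Its value lies in the prolongation because the
anchor preserves brackets, which follows from the Jacobi identity (`LieAlgebroid.act_bracket`,
`anchor_repBracket`). That the properties determine the differential pointwise needs global sections
through every element of the prolongation (`exists_prolSection_val_eq`).
-/

noncomputable section

namespace LieAlgebroidMechanics

/-! ### Derivatives of functions along tangent vectors -/

section DirDeriv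

variable {E' : Type*} [NormedAddCommGroup E'] [NormedSpace ℝ E']
  {H' : Type*} [TopologicalSpace H'] {I' : ModelWithCorners ℝ E' H'}
  {M' : Type*} [TopologicalSpace M'] [ChartedSpace H' M']

theorem dirDeriv_congr {g g' : M' → ℝ} {y : M'} (h : g =ᶠ[𝓝 y] g') :
    dirDeriv I' g y = dirDeriv I' g' y := by
  unfold dirDeriv
  rw [h.mfderiv_eq]

theorem dirDeriv_const (c : ℝ) (y : M') (v : TangentSpace I' y) :
    dirDeriv I' (fun _ : M' => c) y v = 0 := by
  simp only [dirDeriv, mfderiv_const]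
  rfl

theorem dirDeriv_add {g g' : M' → ℝ} {y : M'} (hg : MDifferentiableAt I' 𝓘(ℝ, ℝ) g y)
    (hg' : MDifferentiableAt I' 𝓘(ℝ, ℝ) g' y) (v : TangentSpace I' y) :
    dirDeriv I' (fun z => g z + g' z) y v = dirDeriv I' g y v + dirDeriv I' g' y v := by
  have h := (hg.hasMFDerivAt.add hg'.hasMFDerivAt).mfderiv
  exact DFunLike.congr_fun h v

theorem dirDeriv_mul {g g' : M' → ℝ} {y : M'} (hg : MDifferentiableAt I' 𝓘(ℝ, ℝ) g y)
    (hg' : MDifferentiableAt I' 𝓘(ℝ, ℝ) g' y) (v : TangentSpace I' y) :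
    dirDeriv I' (fun z => g z * g' z) y v =
      g y * dirDeriv I' g' y v + g' y * dirDeriv I' g y v := by
  have h := (hg.hasMFDerivAt.mul hg'.hasMFDerivAt).mfderiv
  exact DFunLike.congr_fun h v

theorem dirDeriv_const_mul {g : M' → ℝ} {y : M'} (hg : MDifferentiableAt I' 𝓘(ℝ, ℝ) g y) (c : ℝ)
    (v : TangentSpace I' y) :
    dirDeriv I' (fun z => c * g z) y v = c * dirDeriv I' g y v := by
  rw [dirDeriv_mul mdifferentiableAt_const hg, dirDeriv_const, mul_zero, add_zero]

theorem dirDeriv_sum {ι : Type*} (s : Finset ι) {g : ι → M' → ℝ} {y : M'}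
    (hg : ∀ i ∈ s, MDifferentiableAt I' 𝓘(ℝ, ℝ) (g i) y) (v : TangentSpace I' y) :
    MDifferentiableAt I' 𝓘(ℝ, ℝ) (fun z => ∑ i ∈ s, g i z) y ∧
    dirDeriv I' (fun z => ∑ i ∈ s, g i z) y v = ∑ i ∈ s, dirDeriv I' (g i) y v := by
  classical
  induction s using Finset.induction_on with
  | empty => exact ⟨by simpa using mdifferentiableAt_const, by simpa using dirDeriv_const 0 y v⟩
  | insert a s ha ih =>
    obtain ⟨h1, h2⟩ := ih fun i hi => hg i (Finset.mem_insert_of_mem hi)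
    have h3 := hg a (Finset.mem_insert_self a s)
    simp only [Finset.sum_insert ha]
    exact ⟨h3.add h1, by rw [dirDeriv_add h3 h1, h2]⟩

theorem dirDeriv_sum_mul {ι : Type*} (s : Finset ι) {a b : ι → M' → ℝ} {y : M'}
    (ha : ∀ i, MDifferentiableAt I' 𝓘(ℝ, ℝ) (a i) y)
    (hb : ∀ i, MDifferentiableAt I' 𝓘(ℝ, ℝ) (b i) y) (v : TangentSpace I' y) :
    dirDeriv I' (fun z => ∑ i ∈ s, a i z * b i z) y v =
      ∑ i ∈ s, (a i y * dirDeriv I' (b i) y v + b i y * dirDeriv I' (a i) y v) := by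
  rw [(dirDeriv_sum s (g := fun i z => a i z * b i z) (fun i _ => (ha i).mul (hb i)) v).2]
  exact Finset.sum_congr rfl fun i _ => dirDeriv_mul (ha i) (hb i) v

theorem dirDeriv_comp {E : Type*} [NormedAddCommGroup E] [NormedSpace ℝ E]
    {H : Type*} [TopologicalSpace H] {I : ModelWithCorners ℝ E H}
    {M : Type*} [TopologicalSpace M] [ChartedSpace H M] {f : M' → M} {g : M → ℝ} {y : M'}
    (hg : MDifferentiableAt I 𝓘(ℝ, ℝ) g (f y)) (hf : MDifferentiableAt I' I f y)
    (v : TangentSpace I' y) :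
    dirDeriv I' (fun z => g (f z)) y v = dirDeriv I g (f y) (mfderiv I' I f y v) :=
  DFunLike.congr_fun (mfderiv_comp y hg hf) v

/-- The derivative of a smooth function along a smooth family of tangent vectors is smooth. -/
theorem contMDiffAt_dirDeriv [IsManifold I' ∞ M']
    {E : Type*} [NormedAddCommGroup E] [NormedSpace ℝ E]
    {H : Type*} [TopologicalSpace H] {I : ModelWithCorners ℝ E H}
    {M : Type*} [TopologicalSpace M] [ChartedSpace H M]
    {g : M' → ℝ} {f : M → M'} {X : ∀ x, TangentSpace I' (f x)} {x : M}
    (hg : ContMDiff I' 𝓘(ℝ, ℝ) ∞ g)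
    (hX : ContMDiffAt I I'.tangent ∞ (fun x => (⟨f x, X x⟩ : TangentBundle I' M')) x) :
    ContMDiffAt I 𝓘(ℝ, ℝ) ∞ (fun x => dirDeriv I' g (f x) (X x)) x := by
  have h1 : ContMDiff I'.tangent 𝓘(ℝ, ℝ).tangent ∞ (tangentMap I' 𝓘(ℝ, ℝ) g) :=
    hg.contMDiff_tangentMap le_rfl
  have h2 := (contMDiff_snd_tangentBundle_modelSpace (n := ∞) (H := ℝ) (I := 𝓘(ℝ, ℝ))).comp h1
  exact (h2 _).comp x hX

end DirDeriv

/-- The Lie bracket of vector fields acts on functions as the commutator of derivations. -/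
theorem dirDeriv_mlieBracket {E' : Type*} [NormedAddCommGroup E'] [NormedSpace ℝ E']
    [CompleteSpace E']
    {H' : Type*} [TopologicalSpace H'] {I' : ModelWithCorners ℝ E' H'} [I'.Boundaryless]
    {M' : Type*} [TopologicalSpace M'] [ChartedSpace H' M'] [IsManifold I' ∞ M']
    {X Y : ∀ y : M', TangentSpace I' y} {g : M' → ℝ}
    (hX : ContMDiff I' I'.tangent ∞ (fun y => (⟨y, X y⟩ : TangentBundle I' M')))
    (hY : ContMDiff I' I'.tangent ∞ (fun y => (⟨y, Y y⟩ : TangentBundle I' M')))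
    (hg : ContMDiff I' 𝓘(ℝ, ℝ) ∞ g) (y : M') :
    dirDeriv I' g y (VectorField.mlieBracket I' X Y y) =
      dirDeriv I' (fun z => dirDeriv I' g z (Y z)) y (X y)
        - dirDeriv I' (fun z => dirDeriv I' g z (X z)) y (Y y) := by
  have : IsManifold I' 2 M' := .of_le (n := ∞) (WithTop.coe_le_coe.2 le_top)
  have : IsManifold I' 1 M' := .of_le (n := ∞) (by simp)
  set φ := extChartAt I' y with hφ
  have hy : y ∈ φ.source := mem_extChartAt_source y
  have hφy : φ y ∈ φ.target := φ.map_source hy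
  have hψφ : φ.symm (φ y) = y := φ.left_inv hy
  have htn : φ.target ∈ 𝓝 (φ y) := extChartAt_target_mem_nhds y
  have hφd : MDifferentiableAt I' 𝓘(ℝ, E') φ y := mdifferentiableAt_extChartAt (mem_chart_source H' y)
  let G : E' → ℝ := g ∘ φ.symm
  have hψs : ∀ z ∈ φ.target, ContMDiffAt 𝓘(ℝ, E') I' ∞ φ.symm z := fun z hz =>
    (contMDiffOn_extChartAt_symm y).contMDiffAt ((isOpen_extChartAt_target y).mem_nhds hz)
  have hGs : ContDiffAt ℝ ∞ G (φ y) := by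
    rw [← contMDiffAt_iff_contDiffAt]
    exact (hg _).comp _ (hψs _ hφy)
  have hGd : DifferentiableAt ℝ G (φ y) := hGs.differentiableAt (by simp)
  -- the vector fields in the chart
  let P : (∀ y : M', TangentSpace I' y) → E' → E' := fun Z =>
    VectorField.mpullback 𝓘(ℝ, E') I' φ.symm Z
  have hP : ∀ Z : ∀ y : M', TangentSpace I' y,
      ContMDiff I' I'.tangent ∞ (fun y => (⟨y, Z y⟩ : TangentBundle I' M')) →
      DifferentiableAt ℝ (P Z) (φ y) := by
    intro Z hZ
    have h := MDifferentiableWithinAt.differentiableWithinAt_mpullbackWithin_vectorField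
      (V := Z) (x := y) (s := univ) (I := I') (((hZ y).mdifferentiableAt (by simp)).mdifferentiableWithinAt)
    simp only [I'.range_eq_univ, preimage_univ, inter_univ, VectorField.mpullbackWithin_univ] at h
    exact differentiableWithinAt_univ.1 h
  have hinv : ∀ z ∈ φ.target, (mfderiv 𝓘(ℝ, E') I' φ.symm z).IsInvertible := by
    intro z hz
    have h := isInvertible_mfderivWithin_extChartAt_symm (I := I') hz
    rwa [I'.range_eq_univ, mfderivWithin_univ] at h
  have hPval : ∀ (Z : ∀ y : M', TangentSpace I' y), ∀ z ∈ φ.target,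
      mfderiv 𝓘(ℝ, E') I' φ.symm z (P Z z) = Z (φ.symm z) := by
    intro Z z hz
    obtain ⟨e, he⟩ := hinv z hz
    simp only [P, VectorField.mpullback_apply, ← he, ContinuousLinearMap.inverse_equiv]
    exact e.apply_symm_apply _
  have hPG : ∀ (Z : ∀ y : M', TangentSpace I' y), ∀ z ∈ φ.target,
      fderiv ℝ G z (P Z z) = dirDeriv I' g (φ.symm z) (Z (φ.symm z)) := by
    intro Z z hz
    rw [← hPval Z z hz, ← dirDeriv_comp (hg.mdifferentiable (by simp) _)
      ((hψs z hz).mdifferentiableAt (by simp))]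
    simp only [dirDeriv, mfderiv_eq_fderiv]
    rfl
  have hdown : ∀ (K : E' → ℝ) (k : M' → ℝ), (∀ z ∈ φ.target, K z = k (φ.symm z)) →
      DifferentiableAt ℝ K (φ y) → ∀ v : TangentSpace I' y,
      dirDeriv I' k y v = fderiv ℝ K (φ y) (mfderiv I' 𝓘(ℝ, E') φ y v) := by
    intro K k hKk hK v
    have h1 : k =ᶠ[𝓝 y] fun w => K (φ w) := by
      filter_upwards [extChartAt_source_mem_nhds (I := I') y] with w hw
      rw [hKk _ (φ.map_source hw), φ.left_inv hw]
    rw [dirDeriv_congr h1, dirDeriv_comp hK.mdifferentiableAt hφd]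
    simp only [dirDeriv, mfderiv_eq_fderiv]
    rfl
  have hPy : ∀ Z : ∀ y : M', TangentSpace I' y, mfderiv I' 𝓘(ℝ, E') φ y (Z y) = P Z (φ y) := by
    intro Z
    have h1 := mfderiv_extChartAt_comp_mfderivWithin_extChartAt_symm (I := I') hφy
    rw [I'.range_eq_univ, mfderivWithin_univ] at h1
    have h2 := DFunLike.congr_fun h1 (P Z (φ y))
    have h3 : mfderiv I' 𝓘(ℝ, E') φ (φ.symm (φ y)) (Z (φ.symm (φ y))) = P Z (φ y) := by
      rw [← hPval Z _ hφy]
      exact h2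
    have h4 : ∀ w, w = y → (mfderiv I' 𝓘(ℝ, E') φ w (Z w) : E') = P Z (φ y) →
        (mfderiv I' 𝓘(ℝ, E') φ y (Z y) : E') = P Z (φ y) := by
      rintro w rfl h
      exact h
    exact h4 _ hψφ h3
  let B : E' := VectorField.lieBracket ℝ (P X) (P Y) (φ y)
  have hbr : mfderiv I' 𝓘(ℝ, E') φ y (VectorField.mlieBracket I' X Y y) = B := by
    have h1 : VectorField.mlieBracket I' X Y y = (mfderiv I' 𝓘(ℝ, E') φ y).inverse B := by
      rw [← VectorField.mlieBracketWithin_univ, VectorField.mlieBracketWithin_apply]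
      simp only [I'.range_eq_univ, preimage_univ, inter_univ, VectorField.mpullbackWithin_univ]
      simp only [B, ← VectorField.lieBracketWithin_univ]
      rfl
    obtain ⟨e, he⟩ := isInvertible_mfderiv_extChartAt (I := I') hy
    rw [h1, ← he, ContinuousLinearMap.inverse_equiv]
    exact e.apply_symm_apply _
  have hG' : DifferentiableAt ℝ (fderiv ℝ G) (φ y) :=
    (hGs.fderiv_right (m := 1) (WithTop.coe_le_coe.2 le_top)).differentiableAt one_ne_zero
  have hsymm : IsSymmSndFDerivAt ℝ G (φ y) := hGs.isSymmSndFDerivAt (by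
    simp only [minSmoothness_of_isRCLikeNormedField]
    exact WithTop.coe_le_coe.2 le_top)
  rw [hdown G g (fun z _ => rfl) hGd, hbr,
    hdown _ _ (hPG Y) (hG'.clm_apply (hP Y hY)), hdown _ _ (hPG X) (hG'.clm_apply (hP X hX)),
    hPy, hPy, fderiv_clm_apply hG' (hP Y hY), fderiv_clm_apply hG' (hP X hX)]
  simp only [B, VectorField.lieBracket, map_sub, add_apply,
    ContinuousLinearMap.comp_apply, ContinuousLinearMap.flip_apply, hsymm (P X (φ y)) (P Y (φ y))]
  abel

/-! ### Global extensions of local objects -/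

section Bump

variable {EM : Type*} [NormedAddCommGroup EM] [NormedSpace ℝ EM] [FiniteDimensional ℝ EM]
  {M : Type*} [TopologicalSpace M] [T2Space M] [ChartedSpace EM M] [IsManifold 𝓘(ℝ, EM) ∞ M]

theorem exists_bump {x : M} {U : Set M} (hU : U ∈ 𝓝 x) :
    ∃ χ : C^∞⟮𝓘(ℝ, EM), M; 𝓘(ℝ, ℝ), ℝ⟯, (∀ᶠ z in 𝓝 x, χ z = 1) ∧ tsupport χ ⊆ U := by
  obtain ⟨φ, -, hφ⟩ := (SmoothBumpFunction.nhds_basis_tsupport (I := 𝓘(ℝ, EM)) x).mem_iff.1 hU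
  exact ⟨⟨φ, φ.contMDiff⟩, φ.eventuallyEq_one, hφ⟩

/-- A tangent vector that annihilates all global smooth functions is zero. -/
theorem tangent_eq_zero {x : M} {v : TangentSpace 𝓘(ℝ, EM) x}
    (h : ∀ g : C^∞⟮𝓘(ℝ, EM), M; 𝓘(ℝ, ℝ), ℝ⟯, dirDeriv 𝓘(ℝ, EM) g x v = 0) : v = 0 := by
  have : IsManifold 𝓘(ℝ, EM) 1 M := .of_le (n := ∞) (by simp)
  set φ := extChartAt 𝓘(ℝ, EM) x
  have hφd : MDifferentiableAt 𝓘(ℝ, EM) 𝓘(ℝ, EM) φ x :=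
    mdifferentiableAt_extChartAt (mem_chart_source EM x)
  obtain ⟨e, he⟩ := isInvertible_mfderiv_extChartAt (I := 𝓘(ℝ, EM)) (mem_extChartAt_source x)
  let w : EM := mfderiv 𝓘(ℝ, EM) 𝓘(ℝ, EM) φ x v
  have hw : w = 0 := by
    refine SeparatingDual.eq_zero_of_forall_dual_eq_zero (R := ℝ) fun l => ?_
    obtain ⟨χ⟩ : Nonempty (SmoothBumpFunction 𝓘(ℝ, EM) x) := inferInstance
    have hs : ContMDiff 𝓘(ℝ, EM) 𝓘(ℝ, ℝ) ∞ fun z => χ z • l (φ z) := by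
      refine χ.contMDiff_smul ?_
      exact l.contMDiff.comp_contMDiffOn contMDiffOn_extChartAt
    have h1 := h ⟨_, hs⟩
    have h2 : (fun z => χ z • l (φ z)) =ᶠ[𝓝 x] fun z => l (φ z) := by
      filter_upwards [χ.eventuallyEq_one] with z hz
      rw [hz]
      exact one_smul _ _
    rw [ContMDiffMap.coeFn_mk, dirDeriv_congr h2,
      dirDeriv_comp (g := l) l.differentiableAt.mdifferentiableAt hφd] at h1
    simp only [dirDeriv, mfderiv_eq_fderiv, l.fderiv] at h1
    exact h1
  have h3 : e v = 0 := by
    have : e v = w := DFunLike.congr_fun he v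
    rw [this, hw]
    rfl
  exact (map_eq_zero_iff e e.injective).1 h3

end Bump

section Frames

variable {EM : Type*} [NormedAddCommGroup EM] [NormedSpace ℝ EM]
  {M : Type*} [TopologicalSpace M] [ChartedSpace EM M]
  {F : Type*} [NormedAddCommGroup F] [NormedSpace ℝ F]
  {V : M → Type*} [TopologicalSpace (TotalSpace F V)]
  [∀ x, AddCommGroup (V x)] [∀ x, Module ℝ (V x)] [∀ x, TopologicalSpace (V x)]
  [FiberBundle F V] [VectorBundle ℝ F V]
  {E' : Type*} [NormedAddCommGroup E'] [NormedSpace ℝ E']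
  {H' : Type*} [TopologicalSpace H'] {I' : ModelWithCorners ℝ E' H'}
  {M' : Type*} [TopologicalSpace M'] [ChartedSpace H' M']

/-- Finite linear combinations, with smooth coefficients, of smooth sections along a map. -/
theorem contMDiffAt_sum_smul_along {H : Type*} [TopologicalSpace H] {I : ModelWithCorners ℝ EM H}
    {M : Type*} [TopologicalSpace M] [ChartedSpace H M]
    {V : M → Type*} [TopologicalSpace (TotalSpace F V)]
    [∀ x, AddCommGroup (V x)] [∀ x, Module ℝ (V x)] [∀ x, TopologicalSpace (V x)]
    [FiberBundle F V] [VectorBundle ℝ F V]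
    {f : M' → M} {y : M'} {ι : Type*} (s : Finset ι) {h : ι → M' → ℝ} {σ : ι → ∀ y, V (f y)}
    (hf : ContMDiffAt I' I ∞ f y) (hh : ∀ i, ContMDiffAt I' 𝓘(ℝ, ℝ) ∞ (h i) y)
    (hσ : ∀ i, ContMDiffAt I' (I.prod 𝓘(ℝ, F)) ∞ (fun z => (⟨f z, σ i z⟩ : TotalSpace F V)) y) :
    ContMDiffAt I' (I.prod 𝓘(ℝ, F)) ∞
      (fun z => (⟨f z, ∑ i ∈ s, h i z • σ i z⟩ : TotalSpace F V)) y := by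
  rw [contMDiffAt_totalSpace]
  refine ⟨hf, ?_⟩
  set e := trivializationAt F V (f y)
  have h1 : ContMDiffAt I' 𝓘(ℝ, F) ∞
      (fun z => ∑ i ∈ s, h i z • (e (⟨f z, σ i z⟩ : TotalSpace F V)).2) y :=
    contMDiffAt_finsetSum fun i _ => (hh i).smul ((contMDiffAt_totalSpace.1 (hσ i)).2)
  refine h1.congr_of_eventuallyEq ?_
  filter_upwards [hf.continuousAt.preimage_mem_nhds
    (e.open_baseSet.mem_nhds (mem_baseSet_trivializationAt F V (f y)))] with z hz
  have h2 : ∀ v : V (f z), (e (⟨f z, v⟩ : TotalSpace F V)).2 = e.linearMapAt ℝ (f z) v := by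
    intro v
    rw [e.coe_linearMapAt_of_mem hz]
  simp only [h2, map_sum, map_smul]

theorem contMDiffAt_add_along {H : Type*} [TopologicalSpace H] {I : ModelWithCorners ℝ EM H}
    {M : Type*} [TopologicalSpace M] [ChartedSpace H M]
    {V : M → Type*} [TopologicalSpace (TotalSpace F V)]
    [∀ x, AddCommGroup (V x)] [∀ x, Module ℝ (V x)] [∀ x, TopologicalSpace (V x)]
    [FiberBundle F V] [VectorBundle ℝ F V]
    {f : M' → M} {y : M'} (h : ℝ) {σ η : ∀ y, V (f y)}
    (hσ : ContMDiffAt I' (I.prod 𝓘(ℝ, F)) ∞ (fun z => (⟨f z, σ z⟩ : TotalSpace F V)) y)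
    (hη : ContMDiffAt I' (I.prod 𝓘(ℝ, F)) ∞ (fun z => (⟨f z, η z⟩ : TotalSpace F V)) y) :
    ContMDiffAt I' (I.prod 𝓘(ℝ, F)) ∞
      (fun z => (⟨f z, σ z + h • η z⟩ : TotalSpace F V)) y := by
  have h1 := contMDiffAt_sum_smul_along (Finset.univ : Finset Bool)
    (h := fun b _ => bif b then 1 else h) (σ := fun b z => bif b then σ z else η z)
    (contMDiffAt_totalSpace.1 hσ).1 (fun _ => contMDiffAt_const)
    (by rintro (_ | _) <;> assumption)
  simpa only [Fintype.sum_bool, cond_true, cond_false, one_smul] using h1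

variable (F V) in
/-- A frame of the vector bundle `V` near `x₀`, given by global smooth sections, together with
global fibrewise linear smooth functions that are the dual coordinates near `x₀`. -/
structure FrameNear (x₀ : M) where
  sec : Fin (Module.finrank ℝ F) → Cₛ^∞⟮𝓘(ℝ, EM); F, V⟯
  coord : Fin (Module.finrank ℝ F) → ∀ x, V x →ₗ[ℝ] ℝ
  contMDiff_coord : ∀ i, ContMDiff (𝓘(ℝ, EM).prod 𝓘(ℝ, F)) 𝓘(ℝ, ℝ) ∞
    (fun a : TotalSpace F V => coord i a.proj a.snd)
  eventually_sum : ∀ᶠ x in 𝓝 x₀, ∀ v : V x, ∑ i, coord i x v • sec i x = v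
  eventually_coord : ∀ᶠ x in 𝓝 x₀, ∀ i j, coord i x (sec j x) = if i = j then 1 else 0

theorem sum_section_apply {ι : Type*} (s : Finset ι) (X : ι → Cₛ^∞⟮𝓘(ℝ, EM); F, V⟯) (x : M) :
    (∑ i ∈ s, X i) x = ∑ i ∈ s, X i x := by
  have h := map_sum (ContMDiffSection.coeAddHom 𝓘(ℝ, EM) F ∞ V) X s
  have h2 := congrFun h x
  simpa only [ContMDiffSection.coeAddHom_apply, Finset.sum_apply] using h2

theorem smulSection_apply (g : C^∞⟮𝓘(ℝ, EM), M; 𝓘(ℝ, ℝ), ℝ⟯) (X : Cₛ^∞⟮𝓘(ℝ, EM); F, V⟯) (x : M) :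
    smulSection g X x = g x • X x := rfl

/-- A section through a given vector: the linear combination of the frame at the base point with
the coordinates of the vector as constant coefficients. -/
def FrameNear.ext {x : M} (Φ : FrameNear (EM := EM) F V x) : V x →ₗ[ℝ] Cₛ^∞⟮𝓘(ℝ, EM); F, V⟯ :=
  ∑ i, (Φ.coord i x).smulRight (Φ.sec i)

theorem FrameNear.ext_apply {x : M} (Φ : FrameNear (EM := EM) F V x) (v : V x) :
    Φ.ext v = ∑ i, Φ.coord i x v • Φ.sec i := by
  simp [FrameNear.ext]

theorem FrameNear.ext_apply_self {x : M} (Φ : FrameNear (EM := EM) F V x) (v : V x) :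
    Φ.ext v x = v := by
  rw [Φ.ext_apply, sum_section_apply]
  exact Φ.eventually_sum.self_of_nhds v

variable [FiniteDimensional ℝ EM] [T2Space M] [IsManifold 𝓘(ℝ, EM) ∞ M]
  [FiniteDimensional ℝ F] [ContMDiffVectorBundle ∞ F V 𝓘(ℝ, EM)]

variable (F V) in
theorem nonempty_frameNear (x₀ : M) : Nonempty (FrameNear (EM := EM) F V x₀) := by
  set e := trivializationAt F V x₀ with he
  let b := Module.finBasis ℝ F
  have hx : e.baseSet ∈ 𝓝 x₀ := e.open_baseSet.mem_nhds (mem_baseSet_trivializationAt F V x₀)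
  obtain ⟨χ, hχ1, hχ⟩ := exists_bump (EM := EM) hx
  have hsec : ∀ i, ContMDiff 𝓘(ℝ, EM) (𝓘(ℝ, EM).prod 𝓘(ℝ, F)) ∞
      (fun x => (⟨x, (⇑χ • fun x => e.symm x (b i)) x⟩ : TotalSpace F V)) := by
    intro i
    refine ContMDiffOn.smul_section_of_tsupport χ.contMDiff.contMDiffOn e.open_baseSet hχ ?_
    rw [e.contMDiffOn_section_baseSet_iff]
    refine (contMDiffOn_const (c := b i)).congr fun y hy => ?_
    rw [e.apply_mk_symm hy]
  refine ⟨⟨fun i => ⟨_, hsec i⟩, fun i x => χ x • (b.coord i ∘ₗ e.linearMapAt ℝ x), fun i => ?_,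
    ?_, ?_⟩⟩
  · intro a
    by_cases ha : a.proj ∈ tsupport χ
    · have h1 : ContMDiffAt (𝓘(ℝ, EM).prod 𝓘(ℝ, F)) 𝓘(ℝ, ℝ) ∞
          (fun a : TotalSpace F V => χ a.proj * LinearMap.toContinuousLinearMap (b.coord i) (e a).2)
          a := by
        refine ContMDiffAt.mul ((χ.contMDiff _).comp _ (contMDiffAt_proj V)) ?_
        refine (ContinuousLinearMap.contMDiff _).contMDiffAt.comp _ ?_
        have h2 := (e.contMDiffOn (n := ∞) (IB := 𝓘(ℝ, EM))).contMDiffAt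
          (e.open_source.mem_nhds (e.mem_source.2 (hχ ha)))
        exact contMDiffAt_snd.comp _ h2
      refine h1.congr_of_eventuallyEq ?_
      filter_upwards [e.open_source.mem_nhds (e.mem_source.2 (hχ ha))] with c hc
      simp [e.coe_linearMapAt_of_mem (e.mem_source.1 hc)]
    · refine (contMDiffAt_const (c := (0 : ℝ))).congr_of_eventuallyEq ?_
      have h1 : (tsupport χ)ᶜ ∈ 𝓝 a.proj := (isClosed_tsupport _).isOpen_compl.mem_nhds ha
      filter_upwards [(contMDiff_proj (n := ∞) (IB := 𝓘(ℝ, EM))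
        V).continuous.continuousAt.preimage_mem_nhds h1] with c hc
      simp [image_eq_zero_of_notMem_tsupport hc]
  · filter_upwards [hχ1, hx] with x h1 hxb v
    have h3 : ∀ w : F, e.symm x w = e.symmₗ ℝ x w := fun w => by
      rw [e.coe_symmₗ hxb]
    have h4 : ∑ i, b.repr (e.linearMapAt ℝ x v) i • e.symmₗ ℝ x (b i) = v := by
      simp_rw [← map_smul, ← map_sum]
      rw [b.sum_repr, e.symmₗ_linearMapAt hxb]
    simpa [h1, h3] using h4
  · filter_upwards [hχ1, hx] with x h1 hxb i j
    have h3 : e.linearMapAt ℝ x (e.symm x (b j)) = b j := by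
      rw [← e.coe_symmₗ (R := ℝ) hxb]
      exact e.linearMapAt_symmₗ hxb (b j)
    simp [h1, h3, Finsupp.single_apply, eq_comm]

end Frames

/-! ### Calculus in a Lie algebroid -/

section Algebroid

variable {EM : Type*} [NormedAddCommGroup EM] [NormedSpace ℝ EM]
  {M : Type*} [TopologicalSpace M] [ChartedSpace EM M] [IsManifold 𝓘(ℝ, EM) ∞ M]
  {F : Type*} [NormedAddCommGroup F] [NormedSpace ℝ F]
  {V : M → Type*} [TopologicalSpace (TotalSpace F V)]
  [∀ x, AddCommGroup (V x)] [∀ x, Module ℝ (V x)] [∀ x, TopologicalSpace (V x)]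
  [FiberBundle F V] [VectorBundle ℝ F V]

theorem LieAlgebroid.contMDiff_anchor_section (A : LieAlgebroid 𝓘(ℝ, EM) F V)
    (X : Cₛ^∞⟮𝓘(ℝ, EM); F, V⟯) :
    ContMDiff 𝓘(ℝ, EM) 𝓘(ℝ, EM).tangent ∞
      (fun x => (⟨x, A.anchor x (X x)⟩ : TangentBundle 𝓘(ℝ, EM) M)) :=
  A.contMDiff_anchor.comp X.contMDiff

/-- The derivative `ρ(X)(g)` of a function along the anchor of a section. -/
def LieAlgebroid.act (A : LieAlgebroid 𝓘(ℝ, EM) F V) (X : Cₛ^∞⟮𝓘(ℝ, EM); F, V⟯)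
    (g : C^∞⟮𝓘(ℝ, EM), M; 𝓘(ℝ, ℝ), ℝ⟯) : C^∞⟮𝓘(ℝ, EM), M; 𝓘(ℝ, ℝ), ℝ⟯ :=
  ⟨fun x => dirDeriv 𝓘(ℝ, EM) g x (A.anchor x (X x)), fun x =>
    contMDiffAt_dirDeriv (f := id) (X := fun x => A.anchor x (X x)) g.contMDiff
      (A.contMDiff_anchor_section X x)⟩

theorem LieAlgebroid.act_apply (A : LieAlgebroid 𝓘(ℝ, EM) F V) (X : Cₛ^∞⟮𝓘(ℝ, EM); F, V⟯)
    (g : C^∞⟮𝓘(ℝ, EM), M; 𝓘(ℝ, ℝ), ℝ⟯) (x : M) :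
    A.act X g x = dirDeriv 𝓘(ℝ, EM) g x (A.anchor x (X x)) := rfl

theorem LieAlgebroid.bracket_swap (A : LieAlgebroid 𝓘(ℝ, EM) F V)
    (X Y : Cₛ^∞⟮𝓘(ℝ, EM); F, V⟯) : A.bracket X Y = -A.bracket Y X := by
  have h := A.bracket_self (X + Y)
  simp only [map_add, LinearMap.add_apply, A.bracket_self, zero_add, add_zero] at h
  exact eq_neg_of_add_eq_zero_right h

theorem LieAlgebroid.bracket_smulSection (A : LieAlgebroid 𝓘(ℝ, EM) F V)
    (X Y : Cₛ^∞⟮𝓘(ℝ, EM); F, V⟯) (g : C^∞⟮𝓘(ℝ, EM), M; 𝓘(ℝ, ℝ), ℝ⟯) :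
    A.bracket X (smulSection g Y) = smulSection g (A.bracket X Y) + smulSection (A.act X g) Y := by
  ext x
  exact A.leibniz X Y g x

theorem LieAlgebroid.bracket_smulSection_left (A : LieAlgebroid 𝓘(ℝ, EM) F V)
    (X Y : Cₛ^∞⟮𝓘(ℝ, EM); F, V⟯) (g : C^∞⟮𝓘(ℝ, EM), M; 𝓘(ℝ, ℝ), ℝ⟯) (x : M) :
    A.bracket (smulSection g X) Y x = g x • A.bracket X Y x - A.act Y g x • X x := by
  rw [A.bracket_swap, A.bracket_swap X Y, A.bracket_smulSection]
  simp only [ContMDiffSection.coe_neg, ContMDiffSection.coe_add, Pi.neg_apply, Pi.add_apply,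
    smulSection_apply]
  rw [smul_neg, neg_add, sub_eq_add_neg]

variable [FiniteDimensional ℝ EM] [T2Space M]

/-- The bracket is a local operator, as multiplication of `X - X'` by a bump function supported where
`X = X'` gives the zero section. -/
theorem LieAlgebroid.bracket_congr_left (A : LieAlgebroid 𝓘(ℝ, EM) F V)
    {X X' : Cₛ^∞⟮𝓘(ℝ, EM); F, V⟯} (Y : Cₛ^∞⟮𝓘(ℝ, EM); F, V⟯) {x : M}
    (h : ∀ᶠ z in 𝓝 x, X z = X' z) : A.bracket X Y x = A.bracket X' Y x := by
  obtain ⟨χ, h1, h2⟩ := exists_bump (EM := EM) h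
  have h3 : smulSection χ (X - X') = 0 := by
    ext z
    by_cases hz : z ∈ tsupport χ
    · have : X z = X' z := h2 hz
      simp [smulSection_apply, this]
    · simp [smulSection_apply, image_eq_zero_of_notMem_tsupport hz]
  have h4 := A.bracket_smulSection_left (X - X') Y χ x
  have h5 : (X - X') x = 0 := by simp [h.self_of_nhds]
  rw [h3, h1.self_of_nhds, h5] at h4
  simp only [map_zero, LinearMap.zero_apply, ContMDiffSection.coe_zero, Pi.zero_apply, one_smul,
    smul_zero, sub_zero, map_sub, LinearMap.sub_apply, ContMDiffSection.coe_sub,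
    Pi.sub_apply] at h4
  exact (sub_eq_zero.1 h4.symm)

variable [FiniteDimensional ℝ F] [ContMDiffVectorBundle ∞ F V 𝓘(ℝ, EM)]

/-- The anchor is a morphism of Lie algebras: the Leibniz rule, applied to the Jacobi identity for
`X`, `Y` and `gZ`, shows that the difference of the two sides annihilates every section `Z`. -/
theorem LieAlgebroid.act_bracket (A : LieAlgebroid 𝓘(ℝ, EM) F V)
    (X Y : Cₛ^∞⟮𝓘(ℝ, EM); F, V⟯) (g : C^∞⟮𝓘(ℝ, EM), M; 𝓘(ℝ, ℝ), ℝ⟯) (x : M) :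
    A.act (A.bracket X Y) g x = A.act X (A.act Y g) x - A.act Y (A.act X g) x := by
  have key : ∀ Z : Cₛ^∞⟮𝓘(ℝ, EM); F, V⟯, (A.act X (A.act Y g) x - A.act Y (A.act X g) x -
      A.act (A.bracket X Y) g x) • Z x = 0 := by
    intro Z
    have hJ : ∀ W, A.bracket (A.bracket X Y) W =
        A.bracket X (A.bracket Y W) - A.bracket Y (A.bracket X W) := by
      intro W
      have h := A.jacobi X Y W
      rw [A.bracket_swap W X, A.bracket_swap W (A.bracket X Y), map_neg] at h
      rw [← sub_eq_zero, ← neg_eq_zero, ← h]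
      abel
    have h1 := congrArg (fun s : Cₛ^∞⟮𝓘(ℝ, EM); F, V⟯ => s x) (hJ (smulSection g Z))
    have h2 := congrArg (fun s : Cₛ^∞⟮𝓘(ℝ, EM); F, V⟯ => s x) (hJ Z)
    simp only [A.bracket_smulSection, map_add, ContMDiffSection.coe_add, ContMDiffSection.coe_sub,
      Pi.add_apply, Pi.sub_apply, smulSection_apply] at h1 h2
    rw [h2] at h1
    simp only [sub_smul]
    linear_combination (norm := module) -h1
  -- in rank zero the anchor vanishes; otherwise some `Z` does not vanish at `x`
  by_cases hF : Subsingleton F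
  · have hV : ∀ (z : M) (v : V z), v = 0 := by
      intro z v
      exact ((trivializationAt F V z).continuousLinearEquivAt ℝ z
        (mem_baseSet_trivializationAt F V z)).injective (Subsingleton.elim _ _)
    have h0 : ∀ (W : Cₛ^∞⟮𝓘(ℝ, EM); F, V⟯) g' z, A.act W g' z = 0 := by
      intro W g' z
      rw [A.act_apply, hV z (W z), map_zero, map_zero]
    rw [h0, h0, h0, sub_zero]
  · rw [not_subsingleton_iff_nontrivial] at hF
    obtain ⟨w, hw⟩ := exists_ne (0 : F)
    obtain ⟨Φ⟩ := nonempty_frameNear (EM := EM) F V x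
    let E := (trivializationAt F V x).continuousLinearEquivAt ℝ x
      (mem_baseSet_trivializationAt F V x)
    have h := key (Φ.ext (E.symm w))
    rw [Φ.ext_apply_self, smul_eq_zero] at h
    rcases h with h | h
    · exact (sub_eq_zero.1 h).symm
    · exact absurd ((map_eq_zero_iff E.symm E.symm.injective).1 h) hw

end Algebroid

/-! ### The bracket of the prolongation -/

section ProlongationBracket

variable {EM : Type*} [NormedAddCommGroup EM] [NormedSpace ℝ EM]
  {M : Type*} [TopologicalSpace M] [ChartedSpace EM M] [IsManifold 𝓘(ℝ, EM) ∞ M]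
  {F : Type*} [NormedAddCommGroup F] [NormedSpace ℝ F]
  {V : M → Type*} [TopologicalSpace (TotalSpace F V)]
  [∀ x, AddCommGroup (V x)] [∀ x, Module ℝ (V x)] [∀ x, TopologicalSpace (V x)]
  [FiberBundle F V] [VectorBundle ℝ F V]
  {E' : Type*} [NormedAddCommGroup E'] [NormedSpace ℝ E']
  {H' : Type*} [TopologicalSpace H'] {I' : ModelWithCorners ℝ E' H'}
  {M' : Type*} [TopologicalSpace M'] [ChartedSpace H' M']

/-- The first component at `y` of the bracket of two sections of the prolongation over `f`,
computed from local expressions `∑ hᵢ (Sᵢ ∘ f)` and `∑ sⱼ (Tⱼ ∘ f)` of their first components and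
from the values `v`, `w` at `y` of their vector fields. -/
def repBracket (A : LieAlgebroid 𝓘(ℝ, EM) F V) (f : M' → M) (y : M') (v w : TangentSpace I' y)
    {ι κ : Type*} [Fintype ι] [Fintype κ]
    (h : ι → C^∞⟮I', M'; 𝓘(ℝ, ℝ), ℝ⟯) (S : ι → Cₛ^∞⟮𝓘(ℝ, EM); F, V⟯)
    (s : κ → C^∞⟮I', M'; 𝓘(ℝ, ℝ), ℝ⟯) (T : κ → Cₛ^∞⟮𝓘(ℝ, EM); F, V⟯) : V (f y) :=
  (∑ i, ∑ j, (h i y * s j y) • A.bracket (S i) (T j) (f y))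
    + (∑ j, dirDeriv I' (s j) y v • T j (f y)) - ∑ i, dirDeriv I' (h i) y w • S i (f y)

variable {ι κ : Type*} [Fintype ι] [Fintype κ]

theorem repBracket_swap (A : LieAlgebroid 𝓘(ℝ, EM) F V) (f : M' → M) (y : M')
    (v w : TangentSpace I' y)
    (h : ι → C^∞⟮I', M'; 𝓘(ℝ, ℝ), ℝ⟯) (S : ι → Cₛ^∞⟮𝓘(ℝ, EM); F, V⟯)
    (s : κ → C^∞⟮I', M'; 𝓘(ℝ, ℝ), ℝ⟯) (T : κ → Cₛ^∞⟮𝓘(ℝ, EM); F, V⟯) :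
    repBracket A f y v w h S s T = -repBracket A f y w v s T h S := by
  unfold repBracket
  have h1 : ∑ i, ∑ j, (h i y * s j y) • A.bracket (S i) (T j) (f y) =
      -∑ j, ∑ i, (s j y * h i y) • A.bracket (T j) (S i) (f y) := by
    rw [Finset.sum_comm]
    simp only [← Finset.sum_neg_distrib]
    refine Finset.sum_congr rfl fun j _ => Finset.sum_congr rfl fun i _ => ?_
    rw [A.bracket_swap (S i), ContMDiffSection.coe_neg, Pi.neg_apply, smul_neg, mul_comm]
  rw [h1]
  abel

/-- The local formula for the bracket, with the second local expression replaced by the section that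
has its coefficients frozen at `y`. -/
theorem repBracket_eq (A : LieAlgebroid 𝓘(ℝ, EM) F V) (f : M' → M) (y : M')
    (v w : TangentSpace I' y)
    (h : ι → C^∞⟮I', M'; 𝓘(ℝ, ℝ), ℝ⟯) (S : ι → Cₛ^∞⟮𝓘(ℝ, EM); F, V⟯)
    (s : κ → C^∞⟮I', M'; 𝓘(ℝ, ℝ), ℝ⟯) (T : κ → Cₛ^∞⟮𝓘(ℝ, EM); F, V⟯) :
    repBracket A f y v w h S s T =
      (∑ j, dirDeriv I' (s j) y v • T j (f y)) +
      ∑ i, (h i y • A.bracket (S i) (∑ j, s j y • T j) (f y)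
        - dirDeriv I' (h i) y w • S i (f y)) := by
  unfold repBracket
  simp only [map_sum, map_smul, sum_section_apply, ContMDiffSection.coe_smul, Pi.smul_apply,
    Finset.smul_sum, smul_smul, Finset.sum_sub_distrib]
  abel

variable [FiniteDimensional ℝ EM] [T2Space M] [FiniteDimensional ℝ F]
  [ContMDiffVectorBundle ∞ F V 𝓘(ℝ, EM)]

/-- The operator `∑ hᵢ (Sᵢ ∘ f) ↦ ∑ hᵢ ⟦Sᵢ, T⟧ ∘ f - w(hᵢ) (Sᵢ ∘ f)` on local expressions kills
those that represent the zero section: by the Leibniz rule it does not change when each `Sᵢ` is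
expanded in a frame, and in a frame all coefficients vanish near `y`. -/
theorem sum_bracket_eq_zero (A : LieAlgebroid 𝓘(ℝ, EM) F V) {f : M' → M} {y : M'}
    (hf : MDifferentiableAt I' 𝓘(ℝ, EM) f y)
    (h : ι → C^∞⟮I', M'; 𝓘(ℝ, ℝ), ℝ⟯) (S : ι → Cₛ^∞⟮𝓘(ℝ, EM); F, V⟯)
    (h0 : ∀ᶠ z in 𝓝 y, ∑ i, h i z • S i (f z) = 0)
    (T : Cₛ^∞⟮𝓘(ℝ, EM); F, V⟯) (w : TangentSpace I' y)
    (hw : A.anchor (f y) (T (f y)) = mfderiv I' 𝓘(ℝ, EM) f y w) :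
    ∑ i, (h i y • A.bracket (S i) T (f y) - dirDeriv I' (h i) y w • S i (f y)) = 0 := by
  obtain ⟨Φ⟩ := nonempty_frameNear (EM := EM) F V (f y)
  let c : ι → Fin (Module.finrank ℝ F) → C^∞⟮𝓘(ℝ, EM), M; 𝓘(ℝ, ℝ), ℝ⟯ := fun i a =>
    ⟨fun x => Φ.coord a x (S i x), (Φ.contMDiff_coord a).comp (S i).contMDiff⟩
  have hS : ∀ i, ∀ᶠ x in 𝓝 (f y), S i x = (∑ a, smulSection (c i a) (Φ.sec a)) x := by
    intro i
    filter_upwards [Φ.eventually_sum] with x hx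
    rw [sum_section_apply]
    exact (hx (S i x)).symm
  have hbr : ∀ i, A.bracket (S i) T (f y) = ∑ a, (c i a (f y) • A.bracket (Φ.sec a) T (f y)
      - dirDeriv I' (fun z => c i a (f z)) y w • Φ.sec a (f y)) := by
    intro i
    rw [A.bracket_congr_left T (hS i), map_sum, LinearMap.sum_apply, sum_section_apply]
    refine Finset.sum_congr rfl fun a _ => ?_
    rw [A.bracket_smulSection_left, A.act_apply, hw,
      dirDeriv_comp ((c i a).contMDiff.mdifferentiable (by simp) _) hf]
  have hd : ∀ i a, MDifferentiableAt I' 𝓘(ℝ, ℝ) (fun z => c i a (f z)) y := fun i a =>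
    ((c i a).contMDiff.mdifferentiable (by simp) (f y)).comp y hf
  have hdh : ∀ i, MDifferentiableAt I' 𝓘(ℝ, ℝ) (h i) y := fun i =>
    (h i).contMDiff.mdifferentiable (by simp) y
  have hzero : ∀ a, ∀ᶠ z in 𝓝 y, ∑ i, h i z * c i a (f z) = 0 := by
    intro a
    filter_upwards [h0] with z hz
    have := congrArg (Φ.coord a (f z)) hz
    simp only [map_sum, map_smul, map_zero, smul_eq_mul] at this
    exact this
  have h1 : ∀ a, ∑ i, h i y * c i a (f y) = 0 := fun a => (hzero a).self_of_nhds
  have h2 : ∀ a, ∑ i, (h i y * dirDeriv I' (fun z => c i a (f z)) y w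
      + c i a (f y) * dirDeriv I' (h i) y w) = 0 := by
    intro a
    have h3 := dirDeriv_congr (I' := I') (g' := fun _ => (0 : ℝ)) (hzero a)
    have h4 := DFunLike.congr_fun h3 w
    rwa [dirDeriv_const, dirDeriv_sum_mul Finset.univ hdh (fun i => hd i a)] at h4
  have hSy : ∀ i, S i (f y) = ∑ a, c i a (f y) • Φ.sec a (f y) := by
    intro i
    have := (hS i).self_of_nhds
    rwa [sum_section_apply] at this
  calc ∑ i, (h i y • A.bracket (S i) T (f y) - dirDeriv I' (h i) y w • S i (f y))
      = ∑ i, ∑ a, ((h i y * c i a (f y)) • A.bracket (Φ.sec a) T (f y)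
          - (h i y * dirDeriv I' (fun z => c i a (f z)) y w
            + c i a (f y) * dirDeriv I' (h i) y w) • Φ.sec a (f y)) := by
        refine Finset.sum_congr rfl fun i _ => ?_
        rw [hbr, hSy, Finset.smul_sum, Finset.smul_sum, ← Finset.sum_sub_distrib]
        refine Finset.sum_congr rfl fun a _ => ?_
        module
    _ = ∑ a, ((∑ i, h i y * c i a (f y)) • A.bracket (Φ.sec a) T (f y)
          - (∑ i, (h i y * dirDeriv I' (fun z => c i a (f z)) y w
            + c i a (f y) * dirDeriv I' (h i) y w)) • Φ.sec a (f y)) := by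
        rw [Finset.sum_comm]
        simp only [Finset.sum_sub_distrib, Finset.sum_smul]
    _ = 0 := by simp only [h1, h2, zero_smul, sub_zero, Finset.sum_const_zero]

theorem repBracket_congr_left (A : LieAlgebroid 𝓘(ℝ, EM) F V) {f : M' → M} {y : M'}
    (hf : MDifferentiableAt I' 𝓘(ℝ, EM) f y) {ι' : Type*} [Fintype ι']
    {h : ι → C^∞⟮I', M'; 𝓘(ℝ, ℝ), ℝ⟯} {S : ι → Cₛ^∞⟮𝓘(ℝ, EM); F, V⟯}
    {h' : ι' → C^∞⟮I', M'; 𝓘(ℝ, ℝ), ℝ⟯} {S' : ι' → Cₛ^∞⟮𝓘(ℝ, EM); F, V⟯}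
    (hS : ∀ᶠ z in 𝓝 y, ∑ i, h i z • S i (f z) = ∑ i, h' i z • S' i (f z))
    (s : κ → C^∞⟮I', M'; 𝓘(ℝ, ℝ), ℝ⟯) (T : κ → Cₛ^∞⟮𝓘(ℝ, EM); F, V⟯)
    (v w : TangentSpace I' y)
    (hw : A.anchor (f y) (∑ j, s j y • T j (f y)) = mfderiv I' 𝓘(ℝ, EM) f y w) :
    repBracket A f y v w h S s T = repBracket A f y v w h' S' s T := by
  rw [repBracket_eq, repBracket_eq, add_right_inj, ← sub_eq_zero]
  have h1 := sum_bracket_eq_zero A hf (Sum.elim h (fun i => -h' i)) (Sum.elim S S') (by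
    filter_upwards [hS] with z hz
    simp [Fintype.sum_sum_type, hz]) (∑ j, s j y • T j) w (by
    rw [← hw]
    simp [sum_section_apply])
  have hneg : ∀ i, dirDeriv I' (-⇑(h' i)) y w = -dirDeriv I' (h' i) y w := by
    intro i
    have : (-⇑(h' i) : M' → ℝ) = fun z => (-1) * h' i z := by
      ext z
      simp
    rw [this, dirDeriv_const_mul ((h' i).contMDiff.mdifferentiable (by simp) y)]
    ring
  rw [Fintype.sum_sum_type] at h1
  simp only [Sum.elim_inl, Sum.elim_inr, ContMDiffMap.coe_neg, hneg, Pi.neg_apply] at h1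
  rw [← h1, sub_eq_add_neg, ← Finset.sum_neg_distrib]
  congr 1
  refine Finset.sum_congr rfl fun i _ => ?_
  module

/-- The local formula for the bracket depends only on the sections represented, not on the local
expressions. -/
theorem repBracket_congr (A : LieAlgebroid 𝓘(ℝ, EM) F V) {f : M' → M} {y : M'}
    (hf : MDifferentiableAt I' 𝓘(ℝ, EM) f y) {ι' κ' : Type*} [Fintype ι'] [Fintype κ']
    {h : ι → C^∞⟮I', M'; 𝓘(ℝ, ℝ), ℝ⟯} {S : ι → Cₛ^∞⟮𝓘(ℝ, EM); F, V⟯}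
    {h' : ι' → C^∞⟮I', M'; 𝓘(ℝ, ℝ), ℝ⟯} {S' : ι' → Cₛ^∞⟮𝓘(ℝ, EM); F, V⟯}
    (hS : ∀ᶠ z in 𝓝 y, ∑ i, h i z • S i (f z) = ∑ i, h' i z • S' i (f z))
    {s : κ → C^∞⟮I', M'; 𝓘(ℝ, ℝ), ℝ⟯} {T : κ → Cₛ^∞⟮𝓘(ℝ, EM); F, V⟯}
    {s' : κ' → C^∞⟮I', M'; 𝓘(ℝ, ℝ), ℝ⟯} {T' : κ' → Cₛ^∞⟮𝓘(ℝ, EM); F, V⟯}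
    (hT : ∀ᶠ z in 𝓝 y, ∑ j, s j z • T j (f z) = ∑ j, s' j z • T' j (f z))
    (v w : TangentSpace I' y)
    (hv : A.anchor (f y) (∑ i, h i y • S i (f y)) = mfderiv I' 𝓘(ℝ, EM) f y v)
    (hw : A.anchor (f y) (∑ j, s j y • T j (f y)) = mfderiv I' 𝓘(ℝ, EM) f y w) :
    repBracket A f y v w h S s T = repBracket A f y v w h' S' s' T' := by
  rw [repBracket_congr_left A hf hS s T v w hw, repBracket_swap,
    repBracket_congr_left A hf hT h' S' w v (by rw [← hS.self_of_nhds, hv]), ← repBracket_swap]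

/-- The local formula for the bracket has its value in the prolongation. It suffices to apply both
sides to functions `g` on `M`, where this is the computation of the commutator of the derivatives
of `g ∘ f` along `X` and `Y`. -/
theorem anchor_repBracket (A : LieAlgebroid 𝓘(ℝ, EM) F V) [FiniteDimensional ℝ E']
    [I'.Boundaryless] [IsManifold I' ∞ M'] {f : M' → M} (hf : ContMDiff I' 𝓘(ℝ, EM) ∞ f)
    (X Y : ProlSection I' A f) (y : M') {ι κ : Type} [Fintype ι] [Fintype κ]
    {h : ι → C^∞⟮I', M'; 𝓘(ℝ, ℝ), ℝ⟯} {S : ι → Cₛ^∞⟮𝓘(ℝ, EM); F, V⟯}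
    {s : κ → C^∞⟮I', M'; 𝓘(ℝ, ℝ), ℝ⟯} {T : κ → Cₛ^∞⟮𝓘(ℝ, EM); F, V⟯}
    (hX : ∀ᶠ z in 𝓝 y, X.fst z = ∑ i, h i z • S i (f z))
    (hY : ∀ᶠ z in 𝓝 y, Y.fst z = ∑ j, s j z • T j (f z)) :
    A.anchor (f y) (repBracket A f y (X.snd y) (Y.snd y) h S s T) =
      mfderiv I' 𝓘(ℝ, EM) f y (VectorField.mlieBracket I' X.snd Y.snd y) := by
  have : CompleteSpace E' := FiniteDimensional.complete ℝ E'
  have hfd : ∀ z, MDifferentiableAt I' 𝓘(ℝ, EM) f z := hf.mdifferentiable (by simp)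
  rw [← sub_eq_zero]
  refine tangent_eq_zero fun g => ?_
  have hgd : ∀ (g : C^∞⟮𝓘(ℝ, EM), M; 𝓘(ℝ, ℝ), ℝ⟯) x, MDifferentiableAt 𝓘(ℝ, EM) 𝓘(ℝ, ℝ) g x :=
    fun g => g.contMDiff.mdifferentiable (by simp)
  -- differentiation of `g ∘ f` along a section of the prolongation
  have hder : ∀ (Z : ProlSection I' A f) {κ : Type} [Fintype κ]
      (s : κ → C^∞⟮I', M'; 𝓘(ℝ, ℝ), ℝ⟯) (T : κ → Cₛ^∞⟮𝓘(ℝ, EM); F, V⟯)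
      (g : C^∞⟮𝓘(ℝ, EM), M; 𝓘(ℝ, ℝ), ℝ⟯) (z : M'), Z.fst z = ∑ j, s j z • T j (f z) →
      dirDeriv I' (fun z => g (f z)) z (Z.snd z) = ∑ j, s j z * A.act (T j) g (f z) := by
    intro Z κ _ s T g z hz
    have hm : A.anchor (f z) (Z.fst z) = mfderiv I' 𝓘(ℝ, EM) f z (Z.snd z) := Z.mem z
    rw [dirDeriv_comp (hgd g _) (hfd z), ← hm, hz]
    simp only [map_sum, map_smul, smul_eq_mul, A.act_apply]
  -- the second derivatives of `g ∘ f`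
  have hder2 : ∀ (Z W : ProlSection I' A f) {ι κ : Type} [Fintype ι] [Fintype κ]
      (h : ι → C^∞⟮I', M'; 𝓘(ℝ, ℝ), ℝ⟯) (S : ι → Cₛ^∞⟮𝓘(ℝ, EM); F, V⟯)
      (s : κ → C^∞⟮I', M'; 𝓘(ℝ, ℝ), ℝ⟯) (T : κ → Cₛ^∞⟮𝓘(ℝ, EM); F, V⟯),
      (∀ᶠ z in 𝓝 y, Z.fst z = ∑ i, h i z • S i (f z)) →
      (∀ᶠ z in 𝓝 y, W.fst z = ∑ j, s j z • T j (f z)) →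
      dirDeriv I' (fun z => dirDeriv I' (fun z => g (f z)) z (W.snd z)) y (Z.snd y) =
        ∑ j, (s j y * ∑ i, h i y * A.act (S i) (A.act (T j) g) (f y)
          + A.act (T j) g (f y) * dirDeriv I' (s j) y (Z.snd y)) := by
    intro Z W ι κ _ _ h S s T hZ hW
    have hd1 : ∀ j, MDifferentiableAt I' 𝓘(ℝ, ℝ) (s j) y := fun j =>
      (s j).contMDiff.mdifferentiable (by simp) y
    have hd2 : ∀ j, MDifferentiableAt I' 𝓘(ℝ, ℝ) (fun z => A.act (T j) g (f z)) y := fun j =>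
      (hgd (A.act (T j) g) (f y)).comp y (hfd y)
    rw [dirDeriv_congr (hW.mono fun z hz => hder W s T g z hz),
      dirDeriv_sum_mul Finset.univ hd1 hd2]
    refine Finset.sum_congr rfl fun j _ => ?_
    rw [← hder Z h S (A.act (T j) g) y hZ.self_of_nhds]
  rw [map_sub, ← dirDeriv_comp (hgd g _) (hfd y),
    dirDeriv_mlieBracket (g := fun z => g (f z)) X.contMDiff_snd Y.contMDiff_snd (g.contMDiff.comp hf),
    hder2 X Y h S s T hX hY, hder2 Y X s T h S hY hX]
  unfold repBracket
  simp only [map_sub, map_add, map_sum, map_smul, smul_eq_mul, ← A.act_apply, A.act_bracket]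
  simp only [mul_sub, Finset.sum_sub_distrib, Finset.sum_add_distrib, Finset.mul_sum]
  have e1 : ∑ i, ∑ j, h i y * s j y * A.act (S i) (A.act (T j) g) (f y) =
      ∑ j, ∑ i, s j y * (h i y * A.act (S i) (A.act (T j) g) (f y)) := by
    rw [Finset.sum_comm]
    exact Finset.sum_congr rfl fun j _ => Finset.sum_congr rfl fun i _ => by ring
  have e2 : ∑ i, ∑ j, h i y * s j y * A.act (T j) (A.act (S i) g) (f y) =
      ∑ i, ∑ j, h i y * (s j y * A.act (T j) (A.act (S i) g) (f y)) :=
    Finset.sum_congr rfl fun i _ => Finset.sum_congr rfl fun j _ => by ring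
  rw [e1, e2]
  simp only [mul_comm (dirDeriv I' _ _ _)]
  ring

end ProlongationBracket

/-! ### Semibasic sections and their differentials -/

section Semibasic

variable {EM : Type*} [NormedAddCommGroup EM] [NormedSpace ℝ EM]
  {M : Type*} [TopologicalSpace M] [ChartedSpace EM M]
  {F : Type*} [NormedAddCommGroup F] [NormedSpace ℝ F]
  {V : M → Type*} [TopologicalSpace (TotalSpace F V)]
  [∀ x, AddCommGroup (V x)] [∀ x, Module ℝ (V x)] [∀ x, TopologicalSpace (V x)]
  [FiberBundle F V]
  {E' : Type*} [NormedAddCommGroup E'] [NormedSpace ℝ E']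
  {H' : Type*} [TopologicalSpace H'] {I' : ModelWithCorners ℝ E' H'}
  {M' : Type*} [TopologicalSpace M'] [ChartedSpace H' M']

/-- The coefficients, in a frame, of a smooth section along a map. -/
def FrameNear.coeff {x : M} (Φ : FrameNear (EM := EM) F V x) {f : M' → M} (σ : ∀ y, V (f y))
    (hσ : ContMDiff I' (𝓘(ℝ, EM).prod 𝓘(ℝ, F)) ∞ (fun y => (⟨f y, σ y⟩ : TotalSpace F V)))
    (i : Fin (Module.finrank ℝ F)) : C^∞⟮I', M'; 𝓘(ℝ, ℝ), ℝ⟯ :=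
  ⟨fun y => Φ.coord i (f y) (σ y), (Φ.contMDiff_coord i).comp hσ⟩

theorem FrameNear.coeff_apply {x : M} (Φ : FrameNear (EM := EM) F V x) {f : M' → M}
    (σ : ∀ y, V (f y))
    (hσ : ContMDiff I' (𝓘(ℝ, EM).prod 𝓘(ℝ, F)) ∞ (fun y => (⟨f y, σ y⟩ : TotalSpace F V)))
    (i : Fin (Module.finrank ℝ F)) (y : M') : Φ.coeff σ hσ i y = Φ.coord i (f y) (σ y) := rfl

theorem FrameNear.isLocalRep {f : M' → M} {y : M'} (Φ : FrameNear (EM := EM) F V (f y))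
    (hf : ContinuousAt f y) (σ : ∀ y, V (f y))
    (hσ : ContMDiff I' (𝓘(ℝ, EM).prod 𝓘(ℝ, F)) ∞ (fun y => (⟨f y, σ y⟩ : TotalSpace F V))) :
    IsLocalRep f σ y (Φ.coeff σ hσ) Φ.sec := by
  filter_upwards [hf.eventually Φ.eventually_sum] with z hz
  exact (hz (σ z)).symm

/-- The derivative at `y` of the function `ψ(B ∘ f)`, where `B` is the extension of a vector by
constant coefficients in a frame. -/
def extDeriv (I' : ModelWithCorners ℝ E' H') {f : M' → M} (ψ : ∀ y, V (f y) →ₗ[ℝ] ℝ) {y : M'}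
    (Φ : FrameNear (EM := EM) F V (f y)) : V (f y) →ₗ[ℝ] TangentSpace I' y →ₗ[ℝ] ℝ :=
  ∑ i, (Φ.coord i (f y)).smulRight (dirDeriv I' (fun z => ψ z (Φ.sec i (f z))) y)

theorem extDeriv_apply' {f : M' → M} (ψ : ∀ y, V (f y) →ₗ[ℝ] ℝ) {y : M'}
    (Φ : FrameNear (EM := EM) F V (f y)) (b : V (f y)) (v : TangentSpace I' y) :
    extDeriv I' ψ Φ b v =
      ∑ i, Φ.coord i (f y) b * dirDeriv I' (fun z => ψ z (Φ.sec i (f z))) y v := by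
  simp [extDeriv, LinearMap.sum_apply]

variable [VectorBundle ℝ F V]

theorem extDeriv_apply {f : M' → M} {ψ : ∀ y, V (f y) →ₗ[ℝ] ℝ}
    (hψ : ∀ X : Cₛ^∞⟮𝓘(ℝ, EM); F, V⟯, ContMDiff I' 𝓘(ℝ, ℝ) ∞ (fun y => ψ y (X (f y)))) {y : M'}
    (Φ : FrameNear (EM := EM) F V (f y)) (b : V (f y)) (v : TangentSpace I' y) :
    extDeriv I' ψ Φ b v = dirDeriv I' (fun z => ψ z (Φ.ext b (f z))) y v := by
  have hd : ∀ i, MDifferentiableAt I' 𝓘(ℝ, ℝ) (fun z => ψ z (Φ.sec i (f z))) y :=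
    fun i => (hψ (Φ.sec i)).mdifferentiable (by simp) y
  have h1 : (fun z => ψ z (Φ.ext b (f z))) =
      fun z => ∑ i, Φ.coord i (f y) b * ψ z (Φ.sec i (f z)) := by
    funext z
    rw [Φ.ext_apply, sum_section_apply]
    simp only [ContMDiffSection.coe_smul, Pi.smul_apply, map_sum, map_smul, smul_eq_mul]
  rw [h1, dirDeriv_sum_mul Finset.univ (a := fun i _ => Φ.coord i (f y) b)
    (fun i => mdifferentiableAt_const) hd, extDeriv_apply']
  simp only [dirDeriv_const, mul_zero, add_zero]

variable [IsManifold 𝓘(ℝ, EM) ∞ M]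

/-- The semibasic section `(b, v) ↦ ψ(b)` of the dual of the prolongation over `f` defined by a
section `ψ` of `f^* V^*`. Both the Poincaré–Cartan section and the Liouville section are of this
form. -/
def semibasic (A : LieAlgebroid 𝓘(ℝ, EM) F V) (f : M' → M) (ψ : ∀ y, V (f y) →ₗ[ℝ] ℝ) (y : M') :
    ProlFiber I' A f y →ₗ[ℝ] ℝ :=
  ψ y ∘ₗ LinearMap.fst ℝ (V (f y)) (TangentSpace I' y) ∘ₗ (ProlFiber I' A f y).subtype

/-- The formula for the differential of a semibasic section at a point, in terms of the extensions
`B`, `C` of the first components by constant coefficients in a frame: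
`((b, v), (c, w)) ↦ v(ψ(C ∘ f)) - w(ψ(B ∘ f)) - ψ(⟦B, C⟧ ∘ f)`. -/
def semibasicDiff (A : LieAlgebroid 𝓘(ℝ, EM) F V) (f : M' → M) (ψ : ∀ y, V (f y) →ₗ[ℝ] ℝ) (y : M')
    (Φ : FrameNear (EM := EM) F V (f y)) :
    ProlFiber I' A f y →ₗ[ℝ] ProlFiber I' A f y →ₗ[ℝ] ℝ :=
  LinearMap.mk₂ ℝ (fun z z' => extDeriv I' ψ Φ z'.1.1 z.1.2 - extDeriv I' ψ Φ z.1.1 z'.1.2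
      - ψ y (A.bracket (Φ.ext z.1.1) (Φ.ext z'.1.1) (f y)))
    (fun z z' u => by
      simp only [Submodule.coe_add, Prod.fst_add, Prod.snd_add, map_add, LinearMap.add_apply,
        ContMDiffSection.coe_add, Pi.add_apply]
      ring)
    (fun c z z' => by
      simp only [Submodule.coe_smul, Prod.smul_fst, Prod.smul_snd, map_smul, LinearMap.smul_apply,
        ContMDiffSection.coe_smul, Pi.smul_apply, smul_eq_mul]
      ring)
    (fun z z' u => by
      simp only [Submodule.coe_add, Prod.fst_add, Prod.snd_add, map_add, LinearMap.add_apply,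
        ContMDiffSection.coe_add, Pi.add_apply]
      ring)
    (fun c z z' => by
      simp only [Submodule.coe_smul, Prod.smul_fst, Prod.smul_snd, map_smul, LinearMap.smul_apply,
        ContMDiffSection.coe_smul, Pi.smul_apply, smul_eq_mul]
      ring)

theorem semibasicDiff_apply (A : LieAlgebroid 𝓘(ℝ, EM) F V) (f : M' → M)
    (ψ : ∀ y, V (f y) →ₗ[ℝ] ℝ) (y : M') (Φ : FrameNear (EM := EM) F V (f y))
    (z z' : ProlFiber I' A f y) :
    semibasicDiff A f ψ y Φ z z' = extDeriv I' ψ Φ z'.1.1 z.1.2 - extDeriv I' ψ Φ z.1.1 z'.1.2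
      - ψ y (A.bracket (Φ.ext z.1.1) (Φ.ext z'.1.1) (f y)) := rfl

variable [FiniteDimensional ℝ EM] [T2Space M] [FiniteDimensional ℝ F]
  [ContMDiffVectorBundle ∞ F V 𝓘(ℝ, EM)]

/-- The bracket of the prolongation exists: computing the local formula at every point in a frame
near that point gives a smooth section, since the outcome does not depend on the frame. -/
theorem exists_isProlBracket {A : LieAlgebroid 𝓘(ℝ, EM) F V} [FiniteDimensional ℝ E']
    [I'.Boundaryless] [IsManifold I' ∞ M'] {f : M' → M} (hf : ContMDiff I' 𝓘(ℝ, EM) ∞ f)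
    (X Y : ProlSection I' A f) : ∃ Z, IsProlBracket X Y Z := by
  have : CompleteSpace E' := FiniteDimensional.complete ℝ E'
  have hfd : ∀ z, MDifferentiableAt I' 𝓘(ℝ, EM) f z := hf.mdifferentiable (by simp)
  let Φ : ∀ x : M, FrameNear (EM := EM) F V x := fun x => (nonempty_frameNear F V x).some
  let σ : ∀ y, V (f y) := fun y => repBracket A f y (X.snd y) (Y.snd y)
    ((Φ (f y)).coeff X.fst X.contMDiff_fst) (Φ (f y)).sec
    ((Φ (f y)).coeff Y.fst Y.contMDiff_fst) (Φ (f y)).sec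
  have hrepX : ∀ y, IsLocalRep f X.fst y ((Φ (f y)).coeff X.fst X.contMDiff_fst) (Φ (f y)).sec :=
    fun y => (Φ (f y)).isLocalRep hf.continuous.continuousAt X.fst X.contMDiff_fst
  have hrepY : ∀ y, IsLocalRep f Y.fst y ((Φ (f y)).coeff Y.fst Y.contMDiff_fst) (Φ (f y)).sec :=
    fun y => (Φ (f y)).isLocalRep hf.continuous.continuousAt Y.fst Y.contMDiff_fst
  have hσ : ∀ (y : M') (k l : ℕ)
      (h : Fin k → C^∞⟮I', M'; 𝓘(ℝ, ℝ), ℝ⟯) (S : Fin k → Cₛ^∞⟮𝓘(ℝ, EM); F, V⟯)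
      (s : Fin l → C^∞⟮I', M'; 𝓘(ℝ, ℝ), ℝ⟯) (T : Fin l → Cₛ^∞⟮𝓘(ℝ, EM); F, V⟯),
      IsLocalRep f X.fst y h S → IsLocalRep f Y.fst y s T →
      σ y = repBracket A f y (X.snd y) (Y.snd y) h S s T := by
    intro y k l h S s T hX hY
    refine repBracket_congr A (hfd y) ?_ ?_ _ _ ?_ ?_
    · filter_upwards [hX, hrepX y] with z h1 h2
      rw [← h1, ← h2]
    · filter_upwards [hY, hrepY y] with z h1 h2
      rw [← h1, ← h2]
    · rw [← (hrepX y).self_of_nhds]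
      exact X.mem y
    · rw [← (hrepY y).self_of_nhds]
      exact Y.mem y
  have hsmooth : ContMDiff I' (𝓘(ℝ, EM).prod 𝓘(ℝ, F)) ∞
      (fun y => (⟨f y, σ y⟩ : TotalSpace F V)) := by
    intro y
    set h := (Φ (f y)).coeff X.fst X.contMDiff_fst
    set s := (Φ (f y)).coeff Y.fst Y.contMDiff_fst
    set e := (Φ (f y)).sec
    have hev : ∀ᶠ z in 𝓝 y, σ z = repBracket A f z (X.snd z) (Y.snd z) h e s e := by
      filter_upwards [eventually_eventually_nhds.2 (hrepX y),
        eventually_eventually_nhds.2 (hrepY y)] with z h1 h2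
      exact hσ z _ _ _ _ _ _ h1 h2
    have hsec : ∀ W : Cₛ^∞⟮𝓘(ℝ, EM); F, V⟯, ContMDiffAt I' (𝓘(ℝ, EM).prod 𝓘(ℝ, F)) ∞
        (fun z => (⟨f z, W (f z)⟩ : TotalSpace F V)) y := fun W => (W.contMDiff.comp hf) y
    have h1 := contMDiffAt_sum_smul_along (Finset.univ : Finset
        (Fin (Module.finrank ℝ F) × Fin (Module.finrank ℝ F)))
      (h := fun ij z => h ij.1 z * s ij.2 z)
      (σ := fun ij z => A.bracket (e ij.1) (e ij.2) (f z)) (hf y)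
      (fun ij => ((h ij.1).contMDiff y).mul ((s ij.2).contMDiff y)) (fun ij => hsec _)
    have h2 := contMDiffAt_sum_smul_along Finset.univ
      (h := fun j z => dirDeriv I' (s j) z (X.snd z)) (σ := fun j z => e j (f z)) (hf y)
      (fun j => contMDiffAt_dirDeriv (f := id) (s j).contMDiff (X.contMDiff_snd y))
      (fun j => hsec _)
    have h3 := contMDiffAt_sum_smul_along Finset.univ
      (h := fun j z => dirDeriv I' (h j) z (Y.snd z)) (σ := fun j z => e j (f z)) (hf y)
      (fun j => contMDiffAt_dirDeriv (f := id) (h j).contMDiff (Y.contMDiff_snd y))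
      (fun j => hsec _)
    refine (contMDiffAt_add_along (-1) (contMDiffAt_add_along 1 h1 h2) h3).congr_of_eventuallyEq ?_
    filter_upwards [hev] with z hz
    rw [hz, repBracket, Fintype.sum_prod_type, one_smul, neg_one_smul, ← sub_eq_add_neg]
  refine ⟨⟨σ, VectorField.mlieBracket I' X.snd Y.snd, hsmooth, fun y => ?_, fun y => ?_⟩,
    fun y => rfl, hσ⟩
  · have : IsManifold I' (((⊤ : ℕ∞) : WithTop ℕ∞) + 1) M' := ‹IsManifold I' ∞ M'›
    have : IsManifold I' (minSmoothness ℝ 2) M' := .of_le (n := ∞) (by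
      simp only [minSmoothness_of_isRCLikeNormedField]
      exact WithTop.coe_le_coe.2 le_top)
    exact ContMDiffAt.mlieBracket_vectorField (m := ⊤) (n := ⊤) (X.contMDiff_snd y)
      (Y.contMDiff_snd y) (by simp only [minSmoothness_of_isRCLikeNormedField]; exact le_rfl)
  · exact anchor_repBracket A hf X Y y (hrepX y) (hrepY y)

theorem isProlBracket_prolBracket {A : LieAlgebroid 𝓘(ℝ, EM) F V} [FiniteDimensional ℝ E']
    [I'.Boundaryless] [IsManifold I' ∞ M'] {f : M' → M} (hf : ContMDiff I' 𝓘(ℝ, EM) ∞ f)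
    (X Y : ProlSection I' A f) : IsProlBracket X Y (prolBracket X Y) :=
  Classical.epsilon_spec (exists_isProlBracket hf X Y)

theorem prolBracket_fst {A : LieAlgebroid 𝓘(ℝ, EM) F V} [FiniteDimensional ℝ E']
    [I'.Boundaryless] [IsManifold I' ∞ M'] {f : M' → M} (hf : ContMDiff I' 𝓘(ℝ, EM) ∞ f)
    (X Y : ProlSection I' A f) (y : M') (Φ : FrameNear (EM := EM) F V (f y)) :
    (prolBracket X Y).fst y = repBracket A f y (X.snd y) (Y.snd y)
      (Φ.coeff X.fst X.contMDiff_fst) Φ.sec (Φ.coeff Y.fst Y.contMDiff_fst) Φ.sec :=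
  (isProlBracket_prolBracket hf X Y).2 y _ _ _ _ _ _
    (Φ.isLocalRep hf.continuous.continuousAt _ _) (Φ.isLocalRep hf.continuous.continuousAt _ _)

/-- Smoothness of `y ↦ ψ y (σ y)` may be tested on the sections `σ = X ∘ f`, since these span. -/
theorem contMDiff_semibasic {f : M' → M} (hf : ContMDiff I' 𝓘(ℝ, EM) ∞ f)
    {ψ : ∀ y, V (f y) →ₗ[ℝ] ℝ}
    (hψ : ∀ X : Cₛ^∞⟮𝓘(ℝ, EM); F, V⟯, ContMDiff I' 𝓘(ℝ, ℝ) ∞ (fun y => ψ y (X (f y))))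
    {σ : ∀ y, V (f y)}
    (hσ : ContMDiff I' (𝓘(ℝ, EM).prod 𝓘(ℝ, F)) ∞ (fun y => (⟨f y, σ y⟩ : TotalSpace F V))) :
    ContMDiff I' 𝓘(ℝ, ℝ) ∞ (fun y => ψ y (σ y)) := by
  intro y
  obtain ⟨Φ⟩ := nonempty_frameNear (EM := EM) F V (f y)
  have h1 : ContMDiffAt I' 𝓘(ℝ, ℝ) ∞
      (fun z => ∑ i, Φ.coeff σ hσ i z * ψ z (Φ.sec i (f z))) y :=
    contMDiffAt_finsetSum fun i _ => ((Φ.coeff σ hσ i).contMDiff y).mul (hψ _ y)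
  refine h1.congr_of_eventuallyEq ?_
  filter_upwards [Φ.isLocalRep hf.continuous.continuousAt σ hσ] with z hz
  rw [hz]
  simp only [map_sum, map_smul, smul_eq_mul]

variable [FiniteDimensional ℝ E'] [I'.Boundaryless] [IsManifold I' ∞ M']

theorem semibasicDiff_val {A : LieAlgebroid 𝓘(ℝ, EM) F V} {f : M' → M}
    (hf : ContMDiff I' 𝓘(ℝ, EM) ∞ f) {ψ : ∀ y, V (f y) →ₗ[ℝ] ℝ}
    (hψ : ∀ X : Cₛ^∞⟮𝓘(ℝ, EM); F, V⟯, ContMDiff I' 𝓘(ℝ, ℝ) ∞ (fun y => ψ y (X (f y))))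
    (X Y : ProlSection I' A f) (y : M') (Φ : FrameNear (EM := EM) F V (f y)) :
    semibasicDiff A f ψ y Φ (X.val y) (Y.val y) =
      dirDeriv I' (fun z => semibasic A f ψ z (Y.val z)) y (X.snd y)
        - dirDeriv I' (fun z => semibasic A f ψ z (X.val z)) y (Y.snd y)
        - semibasic A f ψ y ((prolBracket X Y).val y) := by
  have hd : ∀ i, MDifferentiableAt I' 𝓘(ℝ, ℝ) (fun z => ψ z (Φ.sec i (f z))) y :=
    fun i => (hψ (Φ.sec i)).mdifferentiable (by simp) y
  have hder : ∀ (W : ProlSection I' A f) (v : TangentSpace I' y),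
      dirDeriv I' (fun z => semibasic A f ψ z (W.val z)) y v =
        extDeriv I' ψ Φ (W.fst y) v
          + ∑ i, ψ y (Φ.sec i (f y)) * dirDeriv I' (Φ.coeff W.fst W.contMDiff_fst i) y v := by
    intro W v
    have h1 : (fun z => semibasic A f ψ z (W.val z)) =ᶠ[𝓝 y]
        fun z => ∑ i, Φ.coeff W.fst W.contMDiff_fst i z * ψ z (Φ.sec i (f z)) := by
      filter_upwards [Φ.isLocalRep hf.continuous.continuousAt W.fst W.contMDiff_fst] with z hz
      change ψ z (W.fst z) = _
      rw [hz]
      simp only [map_sum, map_smul, smul_eq_mul]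
    rw [dirDeriv_congr h1, dirDeriv_sum_mul Finset.univ
      (fun i => (Φ.coeff W.fst W.contMDiff_fst i).contMDiff.mdifferentiable (by simp) y) hd,
      Finset.sum_add_distrib, extDeriv_apply']
    rfl
  have hbr : semibasic A f ψ y ((prolBracket X Y).val y) =
      ψ y (A.bracket (Φ.ext (X.fst y)) (Φ.ext (Y.fst y)) (f y))
      + ∑ i, ψ y (Φ.sec i (f y)) * dirDeriv I' (Φ.coeff Y.fst Y.contMDiff_fst i) y (X.snd y)
      - ∑ i, ψ y (Φ.sec i (f y)) * dirDeriv I' (Φ.coeff X.fst X.contMDiff_fst i) y (Y.snd y) := by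
    change ψ y ((prolBracket X Y).fst y) = _
    rw [prolBracket_fst hf X Y y Φ, repBracket, Φ.ext_apply, Φ.ext_apply]
    simp only [map_sub, map_add, map_sum, map_smul, smul_eq_mul, LinearMap.sum_apply,
      LinearMap.smul_apply, sum_section_apply, ContMDiffSection.coe_smul, Pi.smul_apply,
      FrameNear.coeff_apply, Finset.mul_sum, mul_comm (dirDeriv I' _ _ _)]
    congr 2
    rw [Finset.sum_comm]
    exact Finset.sum_congr rfl fun i _ => Finset.sum_congr rfl fun j _ => by ring
  rw [hder, hder, hbr, semibasicDiff_apply]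
  change extDeriv I' ψ Φ (Y.fst y) (X.snd y) - extDeriv I' ψ Φ (X.fst y) (Y.snd y)
    - ψ y (A.bracket (Φ.ext (X.fst y)) (Φ.ext (Y.fst y)) (f y)) = _
  ring

/-- The differential of a semibasic section exists: computing `semibasicDiff` at every point in a
frame near that point satisfies the defining identity. -/
theorem isDifferential_dOne {A : LieAlgebroid 𝓘(ℝ, EM) F V} {f : M' → M}
    (hf : ContMDiff I' 𝓘(ℝ, EM) ∞ f) {ψ : ∀ y, V (f y) →ₗ[ℝ] ℝ}
    (hψ : ∀ X : Cₛ^∞⟮𝓘(ℝ, EM); F, V⟯, ContMDiff I' 𝓘(ℝ, ℝ) ∞ (fun y => ψ y (X (f y)))) :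
    IsDifferential (I' := I') (semibasic A f ψ) (dOne (semibasic A f ψ)) := by
  let Φ : ∀ x : M, FrameNear (EM := EM) F V x := fun x => (nonempty_frameNear F V x).some
  exact Classical.epsilon_spec (p := fun β => IsDifferential (semibasic A f ψ) β)
    ⟨fun y => semibasicDiff A f ψ y (Φ (f y)), fun X Y y => semibasicDiff_val hf hψ X Y y _⟩

/-- If every element of the prolongation is a value of a global section, then the differential of a
semibasic section is given by `semibasicDiff`, in any frame. -/
theorem dOne_semibasic {A : LieAlgebroid 𝓘(ℝ, EM) F V} {f : M' → M}
    (hf : ContMDiff I' 𝓘(ℝ, EM) ∞ f) {ψ : ∀ y, V (f y) →ₗ[ℝ] ℝ}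
    (hψ : ∀ X : Cₛ^∞⟮𝓘(ℝ, EM); F, V⟯, ContMDiff I' 𝓘(ℝ, ℝ) ∞ (fun y => ψ y (X (f y))))
    (hext : ∀ (y : M') (z : ProlFiber I' A f y), ∃ X : ProlSection I' A f, X.val y = z)
    (y : M') (Φ : FrameNear (EM := EM) F V (f y)) :
    dOne (semibasic (I' := I') A f ψ) y = semibasicDiff A f ψ y Φ := by
  refine LinearMap.ext fun z => LinearMap.ext fun z' => ?_
  obtain ⟨X, rfl⟩ := hext y z
  obtain ⟨Y, rfl⟩ := hext y z'
  rw [semibasicDiff_val hf hψ, isDifferential_dOne hf hψ X Y y]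

end Semibasic

/-! ### Frames of the prolongation over the projection of a vector bundle -/

section BundleProlongation

variable {EM : Type*} [NormedAddCommGroup EM]
  {M : Type*} [TopologicalSpace M] [ChartedSpace EM M]
  {G : Type*} [NormedAddCommGroup G]
  {W : M → Type*} [TopologicalSpace (TotalSpace G W)]
  [∀ x, TopologicalSpace (W x)] [FiberBundle G W]

theorem mem_chartAt_source_totalSpace {p₀ p : TotalSpace G W} :
    p ∈ (chartAt (ModelProd EM G) p₀).source ↔
      p.proj ∈ (trivializationAt G W p₀.proj).baseSet ∩ (chartAt EM p₀.proj).source := by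
  rw [FiberBundle.chartedSpace_chartAt]
  simp only [OpenPartialHomeomorph.trans_source, OpenPartialHomeomorph.prod_source,
    OpenPartialHomeomorph.refl_source, mem_inter_iff, mem_preimage, mem_prod, mem_univ, and_true,
    Trivialization.mem_source]
  constructor
  · rintro ⟨h1, h2⟩
    rw [(trivializationAt G W p₀.proj).coe_coe,
      (trivializationAt G W p₀.proj).coe_fst' h1] at h2
    exact ⟨h1, h2⟩
  · rintro ⟨h1, h2⟩
    rw [(trivializationAt G W p₀.proj).coe_coe,
      (trivializationAt G W p₀.proj).coe_fst' h1]
    exact ⟨h1, h2⟩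

variable [NormedSpace ℝ EM] [NormedSpace ℝ G]
  [∀ x, AddCommGroup (W x)] [∀ x, Module ℝ (W x)] [VectorBundle ℝ G W]
  [ContMDiffVectorBundle ∞ G W 𝓘(ℝ, EM)] [IsManifold 𝓘(ℝ, EM) ∞ M]

/-- In the trivializations of the tangent bundles given by charts at `p₀` and at its base point, the
derivative of the bundle projection is the first projection. -/
theorem continuousLinearMapAt_mfderiv_proj {p₀ p : TotalSpace G W}
    (hp : p ∈ (chartAt (ModelProd EM G) p₀).source)
    (v : TangentSpace (𝓘(ℝ, EM).prod 𝓘(ℝ, G)) p) :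
    (trivializationAt EM (TangentSpace 𝓘(ℝ, EM)) p₀.proj).continuousLinearMapAt ℝ p.proj
        (mfderiv (𝓘(ℝ, EM).prod 𝓘(ℝ, G)) 𝓘(ℝ, EM) (TotalSpace.proj : TotalSpace G W → M) p v) =
      ((trivializationAt (EM × G) (TangentSpace (𝓘(ℝ, EM).prod 𝓘(ℝ, G)))
        p₀).continuousLinearMapAt ℝ p v).1 := by
  have h1 := mem_chartAt_source_totalSpace.1 hp
  have hI : IsManifold 𝓘(ℝ, EM) 1 M := .of_le (n := ∞) (by simp)
  have hI' : IsManifold (𝓘(ℝ, EM).prod 𝓘(ℝ, G)) 1 (TotalSpace G W) := .of_le (n := ∞) (by simp)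
  rw [TangentBundle.continuousLinearMapAt_trivializationAt h1.2,
    TangentBundle.continuousLinearMapAt_trivializationAt hp]
  have hproj : MDifferentiableAt (𝓘(ℝ, EM).prod 𝓘(ℝ, G)) 𝓘(ℝ, EM)
      (TotalSpace.proj : TotalSpace G W → M) p :=
    (contMDiff_proj (n := 1) W).mdifferentiable one_ne_zero p
  have hφ : MDifferentiableAt 𝓘(ℝ, EM) 𝓘(ℝ, EM) (extChartAt 𝓘(ℝ, EM) p₀.proj) p.proj :=
    mdifferentiableAt_extChartAt h1.2
  have hψ : MDifferentiableAt (𝓘(ℝ, EM).prod 𝓘(ℝ, G)) 𝓘(ℝ, EM × G)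
      (extChartAt (𝓘(ℝ, EM).prod 𝓘(ℝ, G)) p₀) p := mdifferentiableAt_extChartAt hp
  have heq : (extChartAt 𝓘(ℝ, EM) p₀.proj) ∘ (TotalSpace.proj : TotalSpace G W → M) =ᶠ[𝓝 p]
      (Prod.fst : EM × G → EM) ∘ (extChartAt (𝓘(ℝ, EM).prod 𝓘(ℝ, G)) p₀) := by
    filter_upwards [(trivializationAt G W p₀.proj).open_source.mem_nhds
      ((trivializationAt G W p₀.proj).mem_source.2 h1.1)] with q hq
    rw [FiberBundle.extChartAt]
    change _ = extChartAt 𝓘(ℝ, EM) p₀.proj (trivializationAt G W p₀.proj q).1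
    rw [(trivializationAt G W p₀.proj).coe_fst hq]
    rfl
  have hfst : HasMFDerivAt 𝓘(ℝ, EM × G) 𝓘(ℝ, EM) (Prod.fst : EM × G → EM)
      (extChartAt (𝓘(ℝ, EM).prod 𝓘(ℝ, G)) p₀ p) (ContinuousLinearMap.fst ℝ EM G) :=
    hasFDerivAt_fst.hasMFDerivAt
  have h2 := (hφ.hasMFDerivAt.comp p hproj.hasMFDerivAt).mfderiv
  have h3 := (hfst.comp p hψ.hasMFDerivAt).mfderiv
  rw [heq.mfderiv_eq, h3] at h2
  exact (DFunLike.congr_fun h2 v).symm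

variable {F : Type*} [NormedAddCommGroup F] [NormedSpace ℝ F]
  {V : M → Type*} [TopologicalSpace (TotalSpace F V)]
  [∀ x, AddCommGroup (V x)] [∀ x, Module ℝ (V x)] [∀ x, TopologicalSpace (V x)]
  [FiberBundle F V] [VectorBundle ℝ F V]

/-- The tangent vector at `p` with prescribed projection `u` and prescribed fibre component `k` in
the chart at `p₀`. -/
def chartLift (p₀ : TotalSpace G W) (p : TotalSpace G W) :
    TangentSpace 𝓘(ℝ, EM) p.proj × G →ₗ[ℝ] TangentSpace (𝓘(ℝ, EM).prod 𝓘(ℝ, G)) p :=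
  ((trivializationAt (EM × G) (TangentSpace (𝓘(ℝ, EM).prod 𝓘(ℝ, G))) p₀).symmL ℝ p).toLinearMap ∘ₗ
    LinearMap.prodMap ((trivializationAt EM (TangentSpace 𝓘(ℝ, EM))
      p₀.proj).continuousLinearMapAt ℝ p.proj).toLinearMap LinearMap.id

theorem mfderiv_proj_chartLift {p₀ p : TotalSpace G W}
    (hp : p ∈ (chartAt (ModelProd EM G) p₀).source) (u : TangentSpace 𝓘(ℝ, EM) p.proj × G) :
    mfderiv (𝓘(ℝ, EM).prod 𝓘(ℝ, G)) 𝓘(ℝ, EM) (TotalSpace.proj : TotalSpace G W → M) p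
      (chartLift p₀ p u) = u.1 := by
  have h1 := mem_chartAt_source_totalSpace.1 hp
  have hI : IsManifold 𝓘(ℝ, EM) 1 M := .of_le (n := ∞) (by simp)
  have hI' : IsManifold (𝓘(ℝ, EM).prod 𝓘(ℝ, G)) 1 (TotalSpace G W) := .of_le (n := ∞) (by simp)
  set t := trivializationAt EM (TangentSpace 𝓘(ℝ, EM)) p₀.proj
  set T := trivializationAt (EM × G) (TangentSpace (𝓘(ℝ, EM).prod 𝓘(ℝ, G))) p₀
  have ht : p.proj ∈ t.baseSet := h1.2
  have hT : p ∈ T.baseSet := hp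
  have h2 := continuousLinearMapAt_mfderiv_proj hp (chartLift p₀ p u)
  have h3 : T.continuousLinearMapAt ℝ p (chartLift p₀ p u) =
      (t.continuousLinearMapAt ℝ p.proj u.1, u.2) := T.continuousLinearMapAt_symmL hT _
  rw [h3] at h2
  have h4 := congrArg (t.symmL ℝ p.proj) h2
  rwa [t.symmL_continuousLinearMapAt ht, t.symmL_continuousLinearMapAt ht] at h4

theorem chartLift_injective {p₀ p : TotalSpace G W}
    (hp : p ∈ (chartAt (ModelProd EM G) p₀).source) :
    Function.Injective (chartLift (EM := EM) p₀ p) := by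
  have h1 := mem_chartAt_source_totalSpace.1 hp
  have hI : IsManifold 𝓘(ℝ, EM) 1 M := .of_le (n := ∞) (by simp)
  have hI' : IsManifold (𝓘(ℝ, EM).prod 𝓘(ℝ, G)) 1 (TotalSpace G W) := .of_le (n := ∞) (by simp)
  set t := trivializationAt EM (TangentSpace 𝓘(ℝ, EM)) p₀.proj
  set T := trivializationAt (EM × G) (TangentSpace (𝓘(ℝ, EM).prod 𝓘(ℝ, G))) p₀
  have ht : p.proj ∈ t.baseSet := h1.2
  have hT : p ∈ T.baseSet := hp
  intro u u' h
  have h2 := congrArg (T.continuousLinearMapAt ℝ p) h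
  have h3 : ∀ u, T.continuousLinearMapAt ℝ p (chartLift p₀ p u) =
      (t.continuousLinearMapAt ℝ p.proj u.1, u.2) := fun u => T.continuousLinearMapAt_symmL hT _
  rw [h3, h3, Prod.mk_inj] at h2
  refine Prod.ext ?_ h2.2
  have h4 := congrArg (t.symmL ℝ p.proj) h2.1
  rwa [t.symmL_continuousLinearMapAt ht, t.symmL_continuousLinearMapAt ht] at h4

theorem exists_chartLift_eq {p₀ p : TotalSpace G W}
    (hp : p ∈ (chartAt (ModelProd EM G) p₀).source)
    (v : TangentSpace (𝓘(ℝ, EM).prod 𝓘(ℝ, G)) p) :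
    ∃ k : G, v = chartLift p₀ p (mfderiv (𝓘(ℝ, EM).prod 𝓘(ℝ, G)) 𝓘(ℝ, EM)
      (TotalSpace.proj : TotalSpace G W → M) p v, k) := by
  have hI' : IsManifold (𝓘(ℝ, EM).prod 𝓘(ℝ, G)) 1 (TotalSpace G W) := .of_le (n := ∞) (by simp)
  set T := trivializationAt (EM × G) (TangentSpace (𝓘(ℝ, EM).prod 𝓘(ℝ, G))) p₀ with hT'
  have hT : p ∈ T.baseSet := hp
  refine ⟨(T.continuousLinearMapAt ℝ p v).2, ?_⟩
  have h : T.symmL ℝ p ((trivializationAt EM (TangentSpace 𝓘(ℝ, EM))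
      p₀.proj).continuousLinearMapAt ℝ p.proj (mfderiv (𝓘(ℝ, EM).prod 𝓘(ℝ, G)) 𝓘(ℝ, EM)
      (TotalSpace.proj : TotalSpace G W → M) p v), (T.continuousLinearMapAt ℝ p v).2) = v := by
    rw [continuousLinearMapAt_mfderiv_proj hp v]
    exact T.symmL_continuousLinearMapAt hT v
  exact h.symm

variable [FiniteDimensional ℝ EM] [T2Space M]

/-- Sections of the prolongation with prescribed values near a point: by a cut-off, the pair of a
section `B` of the algebroid and a vector `k` of the typical fibre is lifted to a global section that
near `p₀` has first component `B` and fibre component `k` in the chart. -/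
theorem exists_lift (A : LieAlgebroid 𝓘(ℝ, EM) F V) (p₀ : TotalSpace G W) :
    ∃ Z : Cₛ^∞⟮𝓘(ℝ, EM); F, V⟯ → G →
      ProlSection (𝓘(ℝ, EM).prod 𝓘(ℝ, G)) A (TotalSpace.proj : TotalSpace G W → M),
      ∀ᶠ p in 𝓝 p₀, ∀ B k, (Z B k).fst p = B p.proj ∧
        (Z B k).snd p = chartLift p₀ p (A.anchor p.proj (B p.proj), k) := by
  have hI : IsManifold 𝓘(ℝ, EM) 1 M := .of_le (n := ∞) (by simp)
  have hI' : IsManifold (𝓘(ℝ, EM).prod 𝓘(ℝ, G)) 1 (TotalSpace G W) := .of_le (n := ∞) (by simp)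
  set t := trivializationAt EM (TangentSpace 𝓘(ℝ, EM)) p₀.proj with ht
  set T := trivializationAt (EM × G) (TangentSpace (𝓘(ℝ, EM).prod 𝓘(ℝ, G))) p₀ with hT
  have hproj : ContMDiff (𝓘(ℝ, EM).prod 𝓘(ℝ, G)) 𝓘(ℝ, EM) ∞
    (TotalSpace.proj : TotalSpace G W → M) := contMDiff_proj W
  obtain ⟨χ, hχ1, hχ⟩ := exists_bump (EM := EM) (x := p₀.proj)
    (U := (trivializationAt G W p₀.proj).baseSet ∩ (chartAt EM p₀.proj).source)
    (inter_mem ((trivializationAt G W p₀.proj).open_baseSet.mem_nhds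
      (mem_baseSet_trivializationAt G W p₀.proj))
      ((chartAt EM p₀.proj).open_source.mem_nhds (mem_chart_source EM p₀.proj)))
  let χ' : TotalSpace G W → ℝ := fun p => χ p.proj
  have hχ's : ContMDiff (𝓘(ℝ, EM).prod 𝓘(ℝ, G)) 𝓘(ℝ, ℝ) ∞ χ' := χ.contMDiff.comp hproj
  have hχ' : tsupport χ' ⊆ T.baseSet := by
    intro p hp
    refine mem_chartAt_source_totalSpace.2 (hχ ?_)
    exact tsupport_comp_subset_preimage χ hproj.continuous hp
  have hsmooth : ∀ (B : Cₛ^∞⟮𝓘(ℝ, EM); F, V⟯) (k : G),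
      ContMDiff (𝓘(ℝ, EM).prod 𝓘(ℝ, G)) (𝓘(ℝ, EM).prod 𝓘(ℝ, G)).tangent ∞
      (fun p => (⟨p, (χ' • fun p => chartLift p₀ p (A.anchor p.proj (B p.proj), k)) p⟩ :
        TangentBundle (𝓘(ℝ, EM).prod 𝓘(ℝ, G)) (TotalSpace G W))) := by
    intro B k
    refine ContMDiffOn.smul_section_of_tsupport hχ's.contMDiffOn T.open_baseSet hχ' ?_
    rw [T.contMDiffOn_section_baseSet_iff]
    have h1 : ContMDiffOn 𝓘(ℝ, EM) 𝓘(ℝ, EM) ∞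
        (fun x => (t (⟨x, A.anchor x (B x)⟩ : TangentBundle 𝓘(ℝ, EM) M)).2) t.baseSet :=
      t.contMDiffOn_section_baseSet_iff.1 (A.contMDiff_anchor_section B).contMDiffOn
    have h2 : ContMDiffOn (𝓘(ℝ, EM).prod 𝓘(ℝ, G)) 𝓘(ℝ, EM) ∞
        (fun p : TotalSpace G W =>
          (t (⟨p.proj, A.anchor p.proj (B p.proj)⟩ : TangentBundle 𝓘(ℝ, EM) M)).2) T.baseSet :=
      h1.comp hproj.contMDiffOn fun p hp => (mem_chartAt_source_totalSpace.1 hp).2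
    refine (h2.prodMk_space (contMDiffOn_const (c := k))).congr fun p hp => ?_
    have hpt : p.proj ∈ t.baseSet := (mem_chartAt_source_totalSpace.1 hp).2
    have h3 : T.continuousLinearMapAt ℝ p (chartLift p₀ p (A.anchor p.proj (B p.proj), k)) =
        (t.continuousLinearMapAt ℝ p.proj (A.anchor p.proj (B p.proj)), k) :=
      T.continuousLinearMapAt_symmL hp _
    rw [T.continuousLinearMapAt_apply ℝ, T.coe_linearMapAt_of_mem hp,
      t.continuousLinearMapAt_apply ℝ, t.coe_linearMapAt_of_mem hpt] at h3
    exact h3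
  refine ⟨fun B k => ⟨fun p => χ' p • B p.proj, _, fun p => ?_, hsmooth B k, fun p => ?_⟩, ?_⟩
  · have := contMDiffAt_sum_smul_along (Finset.univ : Finset Unit) (h := fun _ => χ')
      (σ := fun _ p => B p.proj) (hproj p) (fun _ => hχ's p) (fun _ => (B.contMDiff.comp hproj) p)
    simpa using this
  · change A.anchor p.proj (χ' p • B p.proj) = mfderiv _ _ _ p (χ' p • _)
    by_cases hp : p ∈ T.baseSet
    · rw [map_smul, map_smul, mfderiv_proj_chartLift hp]
    · have : χ' p = 0 := image_eq_zero_of_notMem_tsupport fun h => hp (hχ' h)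
      rw [this, zero_smul, zero_smul, map_zero, map_zero]
  · filter_upwards [hproj.continuous.continuousAt.eventually hχ1] with p hp B k
    have : χ' p = 1 := hp
    simp [this]

end BundleProlongation

/-! ### Linear equations for sections of the prolongation -/

theorem contMDiffAt_det {E' : Type*} [NormedAddCommGroup E'] [NormedSpace ℝ E']
    {H' : Type*} [TopologicalSpace H'] {I' : ModelWithCorners ℝ E' H'}
    {M' : Type*} [TopologicalSpace M'] [ChartedSpace H' M'] {ι : Type*} [Fintype ι] [DecidableEq ι]
    {G : M' → Matrix ι ι ℝ} {y : M'}
    (h : ∀ i j, ContMDiffAt I' 𝓘(ℝ, ℝ) ∞ (fun z => G z i j) y) :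
    ContMDiffAt I' 𝓘(ℝ, ℝ) ∞ (fun z => (G z).det) y := by
  simp only [Matrix.det_apply']
  exact contMDiffAt_finsetSum fun σ _ => contMDiffAt_const.mul
    (contMDiffAt_finsetProd fun i _ => h _ _)

section Frame

variable {EM : Type*} [NormedAddCommGroup EM] [NormedSpace ℝ EM]
  {M : Type*} [TopologicalSpace M] [ChartedSpace EM M] [IsManifold 𝓘(ℝ, EM) ∞ M]
  {G : Type*} [NormedAddCommGroup G] [NormedSpace ℝ G]
  {W : M → Type*} [TopologicalSpace (TotalSpace G W)]
  [∀ x, TopologicalSpace (W x)] [FiberBundle G W]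
  [∀ x, AddCommGroup (W x)] [∀ x, Module ℝ (W x)] [VectorBundle ℝ G W]
  [ContMDiffVectorBundle ∞ G W 𝓘(ℝ, EM)]
  {F : Type*} [NormedAddCommGroup F] [NormedSpace ℝ F]
  {V : M → Type*} [TopologicalSpace (TotalSpace F V)]
  [∀ x, AddCommGroup (V x)] [∀ x, Module ℝ (V x)] [∀ x, TopologicalSpace (V x)]
  [FiberBundle F V] [VectorBundle ℝ F V]

theorem ProlSection.eq_of_val_eq {E' : Type*} [NormedAddCommGroup E'] [NormedSpace ℝ E']
    {H' : Type*} [TopologicalSpace H'] {I' : ModelWithCorners ℝ E' H'}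
    {M' : Type*} [TopologicalSpace M'] [ChartedSpace H' M'] [IsManifold I' ∞ M']
    {A : LieAlgebroid 𝓘(ℝ, EM) F V} {f : M' → M} {X Y : ProlSection I' A f}
    (h : ∀ y, X.val y = Y.val y) : X = Y := by
  have h1 : X.fst = Y.fst := funext fun y => congrArg (fun z => z.1.1) (h y)
  have h2 : X.snd = Y.snd := funext fun y => congrArg (fun z => z.1.2) (h y)
  cases X
  cases Y
  simp only [ProlSection.mk.injEq]
  exact ⟨h1, h2⟩

variable [FiniteDimensional ℝ EM] [T2Space M] [FiniteDimensional ℝ F]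
  [ContMDiffVectorBundle ∞ F V 𝓘(ℝ, EM)]

/-- Every element of the prolongation is a value of a global section. -/
theorem exists_prolSection_val_eq (A : LieAlgebroid 𝓘(ℝ, EM) F V) (p : TotalSpace G W)
    (z : ProlFiber (𝓘(ℝ, EM).prod 𝓘(ℝ, G)) A (TotalSpace.proj : TotalSpace G W → M) p) :
    ∃ X : ProlSection (𝓘(ℝ, EM).prod 𝓘(ℝ, G)) A (TotalSpace.proj : TotalSpace G W → M),
      X.val p = z := by
  obtain ⟨Z, hZ⟩ := exists_lift A p
  obtain ⟨Φ⟩ := nonempty_frameNear (EM := EM) F V p.proj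
  obtain ⟨⟨b, v⟩, hz⟩ := z
  obtain ⟨k, hk⟩ := exists_chartLift_eq (p₀ := p) (mem_chart_source _ p) v
  obtain ⟨h1, h2⟩ := hZ.self_of_nhds (Φ.ext b) k
  have hz' : A.anchor p.proj b = mfderiv (𝓘(ℝ, EM).prod 𝓘(ℝ, G)) 𝓘(ℝ, EM)
    (TotalSpace.proj : TotalSpace G W → M) p v := hz
  rw [Φ.ext_apply_self] at h1 h2
  rw [hz', ← hk] at h2
  exact ⟨Z (Φ.ext b) k, Subtype.ext (Prod.ext h1 h2)⟩

variable [FiniteDimensional ℝ G]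

/-- The prolongation has local frames consisting of global sections. -/
theorem exists_prolFrame (A : LieAlgebroid 𝓘(ℝ, EM) F V) (p₀ : TotalSpace G W) :
    ∃ Z : Fin (Module.finrank ℝ F) ⊕ Fin (Module.finrank ℝ G) →
      ProlSection (𝓘(ℝ, EM).prod 𝓘(ℝ, G)) A (TotalSpace.proj : TotalSpace G W → M),
      ∀ᶠ p in 𝓝 p₀, ∃ b : Module.Basis (Fin (Module.finrank ℝ F) ⊕ Fin (Module.finrank ℝ G)) ℝ
        (ProlFiber (𝓘(ℝ, EM).prod 𝓘(ℝ, G)) A (TotalSpace.proj : TotalSpace G W → M) p),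
        ∀ i, b i = (Z i).val p := by
  obtain ⟨Z, hZ⟩ := exists_lift A p₀
  obtain ⟨Φ⟩ := nonempty_frameNear (EM := EM) F V p₀.proj
  let b := Module.finBasis ℝ G
  refine ⟨Sum.elim (fun i => Z (Φ.sec i) 0) (fun j => Z 0 (b j)), ?_⟩
  have hc : ContinuousAt (TotalSpace.proj : TotalSpace G W → M) p₀ :=
    (FiberBundle.continuous_proj G W).continuousAt
  filter_upwards [hZ, (chartAt (ModelProd EM G) p₀).open_source.mem_nhds (mem_chart_source _ p₀),
    hc.eventually Φ.eventually_sum, hc.eventually Φ.eventually_coord] with p hp hps hsum hcoord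
  -- the linear combinations of the frame
  have hcomb : ∀ c : Fin (Module.finrank ℝ F) ⊕ Fin (Module.finrank ℝ G) → ℝ,
      (∑ i, c i • (Sum.elim (fun i => Z (Φ.sec i) 0) (fun j => Z 0 (b j)) i).val p).1 =
        (∑ i, c (.inl i) • Φ.sec i p.proj, chartLift p₀ p
          (A.anchor p.proj (∑ i, c (.inl i) • Φ.sec i p.proj), ∑ j, c (.inr j) • b j)) := by
    intro c
    have hv : ∀ B k, ((Z B k).val p).1 = (B p.proj, chartLift p₀ p
        (A.anchor p.proj (B p.proj), k)) := fun B k => Prod.ext (hp B k).1 (hp B k).2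
    have hu : ((A.anchor p.proj (∑ i, c (.inl i) • Φ.sec i p.proj), ∑ j, c (.inr j) • b j) :
        TangentSpace 𝓘(ℝ, EM) p.proj × G) =
        ∑ i, c (.inl i) • (A.anchor p.proj (Φ.sec i p.proj), 0) +
        ∑ j, c (.inr j) • (0, b j) := by
      refine Prod.ext ?_ ?_
      · simp [Prod.fst_sum, map_sum]
      · simp [Prod.snd_sum]
    have h0 : (0 : Cₛ^∞⟮𝓘(ℝ, EM); F, V⟯) p.proj = 0 := rfl
    rw [Fintype.sum_sum_type, Submodule.coe_add, AddSubmonoidClass.coe_finsetSum,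
      AddSubmonoidClass.coe_finsetSum]
    simp only [Sum.elim_inl, Sum.elim_inr, Submodule.coe_smul, hv, h0, map_zero]
    rw [hu, map_add, map_sum, map_sum]
    refine Prod.ext ?_ ?_
    · simp [Prod.fst_sum]
    · simp only [Prod.snd_add, Prod.snd_sum, Prod.smul_snd, map_smul]
  have hli : LinearIndependent ℝ
      (fun i => (Sum.elim (fun i => Z (Φ.sec i) 0) (fun j => Z 0 (b j)) i).val p) := by
    rw [Fintype.linearIndependent_iff]
    intro c hc0
    have h1 := hcomb c
    rw [hc0] at h1
    obtain ⟨h2, h3⟩ := Prod.mk_inj.1 h1.symm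
    have h4 : ∀ i, c (.inl i) = 0 := by
      intro i
      have := congrArg (Φ.coord i p.proj) h2
      simpa [map_sum, hcoord] using this
    have h5 := chartLift_injective hps (h3.trans (map_zero _).symm)
    have h6 := Fintype.linearIndependent_iff.1 b.linearIndependent _ (congrArg Prod.snd h5)
    rintro (i | j)
    · exact h4 i
    · exact h6 j
  refine ⟨Module.Basis.mk hli ?_, fun i => Module.Basis.mk_apply _ _ i⟩
  rintro ⟨⟨B, v⟩, hz⟩ -
  obtain ⟨k, hk⟩ := exists_chartLift_eq hps v
  have hz' : A.anchor p.proj B = mfderiv (𝓘(ℝ, EM).prod 𝓘(ℝ, G)) 𝓘(ℝ, EM)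
    (TotalSpace.proj : TotalSpace G W → M) p v := hz
  rw [Submodule.mem_span_range_iff_exists_fun]
  refine ⟨Sum.elim (fun i => Φ.coord i p.proj B) (fun j => b.repr k j), Subtype.ext ?_⟩
  rw [hcomb]
  simp only [Sum.elim_inl, Sum.elim_inr, hsum, b.sum_repr, hz', ← hk]

/-- Cramer's rule: a nondegenerate smooth linear equation for sections of the prolongation has a
unique smooth solution. -/
theorem existsUnique_prolSection {A : LieAlgebroid 𝓘(ℝ, EM) F V}
    {β : ∀ p : TotalSpace G W, ProlFiber (𝓘(ℝ, EM).prod 𝓘(ℝ, G)) A TotalSpace.proj p →ₗ[ℝ]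
      ProlFiber (𝓘(ℝ, EM).prod 𝓘(ℝ, G)) A TotalSpace.proj p →ₗ[ℝ] ℝ}
    {α : ∀ p : TotalSpace G W, ProlFiber (𝓘(ℝ, EM).prod 𝓘(ℝ, G)) A TotalSpace.proj p →ₗ[ℝ] ℝ}
    (hinj : ∀ p z, β p z = 0 → z = 0)
    (hβ : ∀ X Y : ProlSection (𝓘(ℝ, EM).prod 𝓘(ℝ, G)) A (TotalSpace.proj : TotalSpace G W → M),
      ContMDiff (𝓘(ℝ, EM).prod 𝓘(ℝ, G)) 𝓘(ℝ, ℝ) ∞ (fun p => β p (X.val p) (Y.val p)))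
    (hα : ∀ X : ProlSection (𝓘(ℝ, EM).prod 𝓘(ℝ, G)) A (TotalSpace.proj : TotalSpace G W → M),
      ContMDiff (𝓘(ℝ, EM).prod 𝓘(ℝ, G)) 𝓘(ℝ, ℝ) ∞ (fun p => α p (X.val p))) :
    ∃! ξ : ProlSection (𝓘(ℝ, EM).prod 𝓘(ℝ, G)) A (TotalSpace.proj : TotalSpace G W → M),
      ∀ p, β p (ξ.val p) = α p := by
  have hinj' : ∀ p, Function.Injective (β p) := fun p =>
    (injective_iff_map_eq_zero (β p)).2 (hinj p)
  have hsurj : ∀ p, ∃ z, β p z = α p := by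
    intro p
    obtain ⟨Z, hZ⟩ := exists_prolFrame A p
    obtain ⟨b, -⟩ := hZ.self_of_nhds
    have := b.finiteDimensional_of_finite
    exact (LinearMap.injective_iff_surjective_of_finrank_eq_finrank
      (V₂ := Module.Dual ℝ _) Subspace.dual_finrank_eq.symm).1 (hinj' p) (α p)
  choose ξ hξ using hsurj
  -- near every point, `ξ` is a combination of a frame with coefficients given by Cramer's rule
  have hlocal : ∀ p₀, ∃ (Z : Fin (Module.finrank ℝ F) ⊕ Fin (Module.finrank ℝ G) →
      ProlSection (𝓘(ℝ, EM).prod 𝓘(ℝ, G)) A (TotalSpace.proj : TotalSpace G W → M))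
      (c : Fin (Module.finrank ℝ F) ⊕ Fin (Module.finrank ℝ G) → TotalSpace G W → ℝ),
      (∀ i, ContMDiffAt (𝓘(ℝ, EM).prod 𝓘(ℝ, G)) 𝓘(ℝ, ℝ) ∞ (c i) p₀) ∧
      ∀ᶠ p in 𝓝 p₀, ξ p = ∑ i, c i p • (Z i).val p := by
    intro p₀
    obtain ⟨Z, hZ⟩ := exists_prolFrame A p₀
    let Q : TotalSpace G W → Matrix (Fin (Module.finrank ℝ F) ⊕ Fin (Module.finrank ℝ G))
      (Fin (Module.finrank ℝ F) ⊕ Fin (Module.finrank ℝ G)) ℝ :=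
      fun p => Matrix.of fun i j => β p ((Z j).val p) ((Z i).val p)
    let r : TotalSpace G W → (Fin (Module.finrank ℝ F) ⊕ Fin (Module.finrank ℝ G)) → ℝ :=
      fun p i => α p ((Z i).val p)
    have hdet : ∀ p, (∃ b : Module.Basis _ ℝ _, ∀ i, b i = (Z i).val p) → (Q p).det ≠ 0 := by
      rintro p ⟨b, hb⟩ h0
      obtain ⟨v, hv0, hv⟩ := Matrix.exists_mulVec_eq_zero_iff.2 h0
      refine hv0 ?_
      have h1 : ∑ j, v j • b j = 0 := by
        refine hinj p _ (b.ext fun i => ?_)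
        have := congrFun hv i
        simp only [Matrix.mulVec, dotProduct, Q, Matrix.of_apply, Pi.zero_apply, ← hb] at this
        simp only [map_sum, map_smul, LinearMap.sum_apply, LinearMap.smul_apply, smul_eq_mul,
          LinearMap.zero_apply, mul_comm (v _), this]
      exact funext (Fintype.linearIndependent_iff.1 b.linearIndependent v h1)
    refine ⟨Z, fun i p => ((Q p).det)⁻¹ * (Q p).cramer (r p) i, fun i => ?_, ?_⟩
    · refine ContMDiffAt.mul (ContMDiffAt.inv₀ (contMDiffAt_det fun i j => hβ _ _ _)
        (hdet p₀ hZ.self_of_nhds)) ?_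
      simp only [Matrix.cramer_apply]
      refine contMDiffAt_det fun k l => ?_
      simp only [Matrix.updateCol_apply]
      split_ifs
      · exact hα _ _
      · exact hβ _ _ _
    · filter_upwards [hZ] with p hp
      have hd := hdet p hp
      obtain ⟨b, hb⟩ := hp
      refine hinj' p ((hξ p).trans (b.ext fun i => ?_))
      have h1 := congrFun (Matrix.mulVec_cramer (Q p) (r p)) i
      simp only [Matrix.mulVec, dotProduct, Pi.smul_apply, smul_eq_mul] at h1
      simp only [map_sum, map_smul, LinearMap.sum_apply, LinearMap.smul_apply, smul_eq_mul, hb]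
      calc α p ((Z i).val p) = ((Q p).det)⁻¹ * ((Q p).det * r p i) := by
            rw [inv_mul_cancel_left₀ hd]
        _ = _ := by
            rw [← h1, Finset.mul_sum]
            exact Finset.sum_congr rfl fun j _ => by
              simp only [Q, Matrix.of_apply]
              ring
  refine ⟨⟨fun p => (ξ p).1.1, fun p => (ξ p).1.2, fun p => ?_, fun p => ?_, fun p => (ξ p).2⟩,
    hξ, fun η hη => ProlSection.eq_of_val_eq fun p => hinj' p ((hη p).trans (hξ p).symm)⟩
  · obtain ⟨Z, c, hc, h⟩ := hlocal p
    refine (contMDiffAt_sum_smul_along Finset.univ (contMDiff_proj W p) hc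
      fun i => (Z i).contMDiff_fst p).congr_of_eventuallyEq ?_
    filter_upwards [h] with q hq
    rw [hq, AddSubmonoidClass.coe_finsetSum, Prod.fst_sum]
    rfl
  · obtain ⟨Z, c, hc, h⟩ := hlocal p
    refine (contMDiffAt_sum_smul_along (f := id) Finset.univ contMDiffAt_id hc
      fun i => (Z i).contMDiff_snd p).congr_of_eventuallyEq ?_
    filter_upwards [h] with q hq
    rw [hq, AddSubmonoidClass.coe_finsetSum, Prod.snd_sum]
    rfl

end Frame

/-! ### Vertical vectors -/

section Vertical

variable {EM : Type*} [NormedAddCommGroup EM] [NormedSpace ℝ EM]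
  {M : Type*} [TopologicalSpace M] [ChartedSpace EM M] [IsManifold 𝓘(ℝ, EM) ∞ M]
  {G : Type*} [NormedAddCommGroup G] [NormedSpace ℝ G]
  {W : M → Type*} [TopologicalSpace (TotalSpace G W)]
  [∀ x, AddCommGroup (W x)] [∀ x, Module ℝ (W x)] [∀ x, TopologicalSpace (W x)]
  [FiberBundle G W] [VectorBundle ℝ G W]

theorem hasDerivAt_vertLift {g : TotalSpace G W → ℝ} {p : TotalSpace G W}
    (hg : MDifferentiableAt (𝓘(ℝ, EM).prod 𝓘(ℝ, G)) 𝓘(ℝ, ℝ) g p) (b : W p.proj) :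
    HasDerivAt (fun t : ℝ => g ⟨p.proj, p.snd + t • b⟩)
      (dirDeriv (𝓘(ℝ, EM).prod 𝓘(ℝ, G)) g p (vertLift 𝓘(ℝ, EM) p b)) 0 := by
  have h := hasMFDerivAt_vertLift (I := 𝓘(ℝ, EM)) p b
  have hp : (⟨p.proj, p.snd + (0 : ℝ) • b⟩ : TotalSpace G W) = p := by simp
  have key : ∀ c : TotalSpace G W, c = p →
      HasMFDerivAt (𝓘(ℝ, EM).prod 𝓘(ℝ, G)) 𝓘(ℝ, ℝ) g c
        (mfderiv (𝓘(ℝ, EM).prod 𝓘(ℝ, G)) 𝓘(ℝ, ℝ) g p : EM × G →L[ℝ] ℝ) := by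
    rintro c rfl
    exact hg.hasMFDerivAt
  have h1 := HasMFDerivAt.comp (x := (0 : ℝ)) (g := g)
    (f := fun t : ℝ => (⟨p.proj, p.snd + t • b⟩ : TotalSpace G W)) (key _ hp) h
  let D : EM × G →L[ℝ] ℝ := mfderiv (𝓘(ℝ, EM).prod 𝓘(ℝ, G)) 𝓘(ℝ, ℝ) g p
  let w : EM × G := vertLift 𝓘(ℝ, EM) p b
  have h2 : HasFDerivAt (fun t : ℝ => g ⟨p.proj, p.snd + t • b⟩)
      (D.comp ((ContinuousLinearMap.id ℝ ℝ).smulRight w)) 0 :=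
    hasMFDerivAt_iff_hasFDerivAt.1 h1
  refine h2.hasDerivAt.congr_deriv ?_
  change D ((1 : ℝ) • w) = D w
  rw [one_smul]

variable [ContMDiffVectorBundle ∞ G W 𝓘(ℝ, EM)]

/-- The kernel of the derivative of the projection consists of vertical lifts. -/
theorem exists_vertLift_eq {p : TotalSpace G W} {v : TangentSpace (𝓘(ℝ, EM).prod 𝓘(ℝ, G)) p}
    (hv : mfderiv (𝓘(ℝ, EM).prod 𝓘(ℝ, G)) 𝓘(ℝ, EM) (TotalSpace.proj : TotalSpace G W → M) p v = 0) :
    ∃ b : W p.proj, vertLift 𝓘(ℝ, EM) p b = v := by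
  have hI' : IsManifold (𝓘(ℝ, EM).prod 𝓘(ℝ, G)) 1 (TotalSpace G W) := .of_le (n := ∞) (by simp)
  have h := continuousLinearMapAt_mfderiv_proj (mem_chart_source _ p) v
  rw [hv, map_zero, TangentBundle.continuousLinearMapAt_trivializationAt (mem_chart_source _ p),
    mfderiv_extChartAt_self] at h
  have h1 : (v : EM × G).1 = 0 := h.symm
  set e := trivializationAt G W p.proj
  have he : p.proj ∈ e.baseSet := mem_baseSet_trivializationAt G W p.proj
  refine ⟨e.symmL ℝ p.proj (v : EM × G).2, ?_⟩
  refine Prod.ext h1.symm ?_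
  exact e.continuousLinearMapAt_symmL he _

end Vertical

/-! ### The canonical symplectic section -/

theorem eq_zero_of_forall_continuousDual {F : Type*} [NormedAddCommGroup F] [NormedSpace ℝ F]
    {X : Type*} [AddCommGroup X] [Module ℝ X] [TopologicalSpace X] (e : X ≃L[ℝ] F) {v : X}
    (h : ∀ α : X →L[ℝ] ℝ, α v = 0) : v = 0 := by
  refine e.map_eq_zero_iff.1 (SeparatingDual.eq_zero_of_forall_dual_eq_zero (R := ℝ) fun l => ?_)
  exact h (l.comp (e : X →L[ℝ] F))

section Dual

variable {EM : Type*} [NormedAddCommGroup EM] [NormedSpace ℝ EM]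
  {M : Type*} [TopologicalSpace M] [ChartedSpace EM M]
  {F : Type*} [NormedAddCommGroup F] [NormedSpace ℝ F]
  {V : M → Type*} [TopologicalSpace (TotalSpace F V)]
  [∀ x, AddCommGroup (V x)] [∀ x, Module ℝ (V x)] [∀ x, TopologicalSpace (V x)]
  [FiberBundle F V] [VectorBundle ℝ F V]

/-- The evaluation of covectors on a smooth section along a smooth map is smooth. -/
theorem contMDiff_dual_apply {E' : Type*} [NormedAddCommGroup E'] [NormedSpace ℝ E']
    {H' : Type*} [TopologicalSpace H'] {I' : ModelWithCorners ℝ E' H'}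
    {M' : Type*} [TopologicalSpace M'] [ChartedSpace H' M'] {f : M' → M}
    {φ : ∀ y, V (f y) →L[ℝ] ℝ} {v : ∀ y, V (f y)}
    (hφ : ContMDiff I' (𝓘(ℝ, EM).prod 𝓘(ℝ, F →L[ℝ] ℝ)) ∞
      (fun y => (⟨f y, φ y⟩ : TotalSpace (F →L[ℝ] ℝ) (fun x => V x →L[ℝ] ℝ))))
    (hv : ContMDiff I' (𝓘(ℝ, EM).prod 𝓘(ℝ, F)) ∞ (fun y => (⟨f y, v y⟩ : TotalSpace F V))) :
    ContMDiff I' 𝓘(ℝ, ℝ) ∞ (fun y => φ y (v y)) := by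
  have h := ContMDiff.clm_bundle_apply (E₂ := Bundle.Trivial M ℝ) (F₂ := ℝ) (b := f) hφ hv
  intro y
  exact (contMDiffAt_totalSpace.1 (h y)).2

/-- The tautological section of the pullback of the dual bundle to its own total space. -/
def tautological (p : TotalSpace (F →L[ℝ] ℝ) (fun x => V x →L[ℝ] ℝ)) : V p.proj →ₗ[ℝ] ℝ :=
  p.snd.toLinearMap

theorem contMDiff_tautological (X : Cₛ^∞⟮𝓘(ℝ, EM); F, V⟯) :
    ContMDiff (𝓘(ℝ, EM).prod 𝓘(ℝ, F →L[ℝ] ℝ)) 𝓘(ℝ, ℝ) ∞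
      (fun p : TotalSpace (F →L[ℝ] ℝ) (fun x => V x →L[ℝ] ℝ) => tautological p (X p.proj)) :=
  contMDiff_dual_apply (M' := TotalSpace (F →L[ℝ] ℝ) (fun x => V x →L[ℝ] ℝ)) (f := TotalSpace.proj)
    (φ := fun p => p.snd) (v := fun p => X p.proj) contMDiff_id (X.contMDiff.comp (contMDiff_proj _))

variable [IsManifold 𝓘(ℝ, EM) ∞ M]

/-- Along the vertical lift of `α`, the function `p ↦ p(b)` has derivative `α(b)`. -/
theorem extDeriv_tautological_vertLift {p : TotalSpace (F →L[ℝ] ℝ) (fun x => V x →L[ℝ] ℝ)}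
    (Φ : FrameNear (EM := EM) F V p.proj) (b : V p.proj) (α : V p.proj →L[ℝ] ℝ) :
    extDeriv (𝓘(ℝ, EM).prod 𝓘(ℝ, F →L[ℝ] ℝ)) tautological Φ b (vertLift 𝓘(ℝ, EM) p α) = α b := by
  rw [extDeriv_apply contMDiff_tautological]
  have h1 := hasDerivAt_vertLift (p := p)
    ((contMDiff_tautological (Φ.ext b)).mdifferentiable (by simp) p) α
  have h2 : HasDerivAt (fun t : ℝ => p.snd b + t * α b) (α b) 0 := by
    simpa using ((hasDerivAt_id (0 : ℝ)).mul_const (α b)).const_add (p.snd b)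
  refine h1.unique (h2.congr_of_eventuallyEq (Eventually.of_forall fun t => ?_))
  change (p.snd + t • α) (Φ.ext b p.proj) = _
  rw [Φ.ext_apply_self]
  rfl

variable [ContMDiffVectorBundle ∞ F V 𝓘(ℝ, EM)] [FiniteDimensional ℝ EM] [T2Space M]
  [FiniteDimensional ℝ F]

theorem canonicalSymplectic_apply (A : LieAlgebroid 𝓘(ℝ, EM) F V)
    (p : TotalSpace (F →L[ℝ] ℝ) (fun x => V x →L[ℝ] ℝ)) (Φ : FrameNear (EM := EM) F V p.proj)
    (z z' : ProlFiber (𝓘(ℝ, EM).prod 𝓘(ℝ, F →L[ℝ] ℝ)) A TotalSpace.proj p) :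
    canonicalSymplectic A p z z' = -semibasicDiff A TotalSpace.proj tautological p Φ z z' := by
  rw [canonicalSymplectic, LinearMap.neg_apply, LinearMap.neg_apply]
  change -dOne (semibasic A TotalSpace.proj tautological) p z z' = _
  rw [dOne_semibasic (contMDiff_proj _) contMDiff_tautological (exists_prolSection_val_eq A)]

/-- The canonical symplectic section is nondegenerate. -/
theorem eq_zero_of_canonicalSymplectic_eq_zero {A : LieAlgebroid 𝓘(ℝ, EM) F V}
    {p : TotalSpace (F →L[ℝ] ℝ) (fun x => V x →L[ℝ] ℝ)}
    {z : ProlFiber (𝓘(ℝ, EM).prod 𝓘(ℝ, F →L[ℝ] ℝ)) A TotalSpace.proj p}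
    (h : canonicalSymplectic A p z = 0) : z = 0 := by
  obtain ⟨Φ⟩ := nonempty_frameNear (EM := EM) F V p.proj
  have h0 : ∀ z', semibasicDiff A TotalSpace.proj tautological p Φ z z' = 0 := fun z' => by
    rw [← neg_eq_zero, ← canonicalSymplectic_apply, h, LinearMap.zero_apply]
  obtain ⟨⟨b, v⟩, hz⟩ := z
  -- pairing with vertical lifts
  have hb : b = 0 := by
    refine eq_zero_of_forall_continuousDual ((trivializationAt F V p.proj).continuousLinearEquivAt ℝ
      p.proj (mem_baseSet_trivializationAt F V p.proj)) fun α => ?_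
    have h1 := h0 ⟨(0, vertLift 𝓘(ℝ, EM) p α),
      (map_zero (A.anchor p.proj)).trans (mfderiv_proj_vertLift p α).symm⟩
    rw [semibasicDiff_apply] at h1
    simpa [extDeriv_tautological_vertLift] using h1
  subst hb
  have hv : mfderiv (𝓘(ℝ, EM).prod 𝓘(ℝ, F →L[ℝ] ℝ)) 𝓘(ℝ, EM)
      (TotalSpace.proj : TotalSpace (F →L[ℝ] ℝ) (fun x => V x →L[ℝ] ℝ) → M) p v = 0 :=
    hz.symm.trans (map_zero (A.anchor p.proj))
  obtain ⟨ζ, rfl⟩ := exists_vertLift_eq hv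
  -- pairing with lifts of the vectors of the algebroid
  have hζ : ζ = 0 := by
    ext c
    have h1 := h0 ⟨(c, chartLift p p (A.anchor p.proj c, 0)),
      (mfderiv_proj_chartLift (mem_chart_source _ p) (A.anchor p.proj c, 0)).symm⟩
    rw [semibasicDiff_apply] at h1
    simpa [extDeriv_tautological_vertLift] using h1
  subst hζ
  exact Subtype.ext (Prod.ext rfl (map_zero (vertLift 𝓘(ℝ, EM) p)))

end Dual

/-! ### The Legendre transformation -/

section Smoothness

variable {EM : Type*} [NormedAddCommGroup EM] [NormedSpace ℝ EM] [FiniteDimensional ℝ EM]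
  {M : Type*} [TopologicalSpace M] [T2Space M] [ChartedSpace EM M] [IsManifold 𝓘(ℝ, EM) ∞ M]
  {F : Type*} [NormedAddCommGroup F] [NormedSpace ℝ F] [FiniteDimensional ℝ F]
  {V : M → Type*} [TopologicalSpace (TotalSpace F V)]
  [∀ x, AddCommGroup (V x)] [∀ x, Module ℝ (V x)] [∀ x, TopologicalSpace (V x)]
  [FiberBundle F V] [VectorBundle ℝ F V] [ContMDiffVectorBundle ∞ F V 𝓘(ℝ, EM)]
  {E' : Type*} [NormedAddCommGroup E'] [NormedSpace ℝ E'] [FiniteDimensional ℝ E']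
  {H' : Type*} [TopologicalSpace H'] {I' : ModelWithCorners ℝ E' H'} [I'.Boundaryless]
  {M' : Type*} [TopologicalSpace M'] [ChartedSpace H' M'] [IsManifold I' ∞ M']

theorem contMDiff_dOne_semibasic {A : LieAlgebroid 𝓘(ℝ, EM) F V} {f : M' → M}
    (hf : ContMDiff I' 𝓘(ℝ, EM) ∞ f) {ψ : ∀ y, V (f y) →ₗ[ℝ] ℝ}
    (hψ : ∀ X : Cₛ^∞⟮𝓘(ℝ, EM); F, V⟯, ContMDiff I' 𝓘(ℝ, ℝ) ∞ (fun y => ψ y (X (f y))))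
    (X Y : ProlSection I' A f) :
    ContMDiff I' 𝓘(ℝ, ℝ) ∞ (fun y => dOne (semibasic A f ψ) y (X.val y) (Y.val y)) := by
  have h : ∀ Z : ProlSection I' A f,
      ContMDiff I' 𝓘(ℝ, ℝ) ∞ (fun y => semibasic A f ψ y (Z.val y)) :=
    fun Z => contMDiff_semibasic hf hψ Z.contMDiff_fst
  have h2 : ∀ Z Z' : ProlSection I' A f, ContMDiff I' 𝓘(ℝ, ℝ) ∞
      (fun y => dirDeriv I' (fun z => semibasic A f ψ z (Z.val z)) y (Z'.snd y)) :=
    fun Z Z' y => contMDiffAt_dirDeriv (f := id) (h Z) (Z'.contMDiff_snd y)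
  simp only [isDifferential_dOne hf hψ X Y]
  exact ((h2 Y X).sub (h2 X Y)).sub (h _)

end Smoothness

section Legendre

variable {EM : Type*} [NormedAddCommGroup EM] [NormedSpace ℝ EM]
  {M : Type*} [TopologicalSpace M] [ChartedSpace EM M] [IsManifold 𝓘(ℝ, EM) ∞ M]
  {F : Type*} [NormedAddCommGroup F] [NormedSpace ℝ F]
  {V : M → Type*} [TopologicalSpace (TotalSpace F V)]
  [∀ x, AddCommGroup (V x)] [∀ x, Module ℝ (V x)] [∀ x, TopologicalSpace (V x)]
  [FiberBundle F V] [VectorBundle ℝ F V]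
  {L : TotalSpace F V → ℝ}

/-- The section `a ↦ Leg_L(a)` of the pullback of the dual bundle to the total space of `V`. -/
def legendreSection (L : TotalSpace F V → ℝ) (a : TotalSpace F V) : V a.proj →ₗ[ℝ] ℝ :=
  (legendre 𝓘(ℝ, EM) L a).snd.toLinearMap

variable [ContMDiffVectorBundle ∞ F V 𝓘(ℝ, EM)]

theorem IsHyperregular.contMDiff (hL : IsHyperregular 𝓘(ℝ, EM) L) :
    ContMDiff (𝓘(ℝ, EM).prod 𝓘(ℝ, F)) (𝓘(ℝ, EM).prod 𝓘(ℝ, F →L[ℝ] ℝ)) ∞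
      (legendre 𝓘(ℝ, EM) L) :=
  hL.coe_diffeo ▸ hL.diffeo.contMDiff

theorem IsHyperregular.mfderiv_bijective (hL : IsHyperregular 𝓘(ℝ, EM) L) (a : TotalSpace F V) :
    Function.Bijective (mfderiv (𝓘(ℝ, EM).prod 𝓘(ℝ, F)) (𝓘(ℝ, EM).prod 𝓘(ℝ, F →L[ℝ] ℝ))
      (legendre 𝓘(ℝ, EM) L) a) := by
  have key : ∀ f : TotalSpace F V → TotalSpace (F →L[ℝ] ℝ) (fun x => V x →L[ℝ] ℝ),
      f = hL.diffeo → Function.Bijective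
        (mfderiv (𝓘(ℝ, EM).prod 𝓘(ℝ, F)) (𝓘(ℝ, EM).prod 𝓘(ℝ, F →L[ℝ] ℝ)) f a) := by
    rintro f rfl
    exact (hL.diffeo.mfderivToContinuousLinearEquiv (by simp) a).bijective
  exact key _ hL.coe_diffeo.symm

theorem IsHyperregular.symm_legendre (hL : IsHyperregular 𝓘(ℝ, EM) L) (a : TotalSpace F V) :
    hL.diffeo.symm (legendre 𝓘(ℝ, EM) L a) = a := by
  rw [← hL.coe_diffeo, hL.diffeo.symm_apply_apply]

theorem IsHyperregular.legendre_symm (hL : IsHyperregular 𝓘(ℝ, EM) L)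
    (p : TotalSpace (F →L[ℝ] ℝ) (fun x => V x →L[ℝ] ℝ)) :
    legendre 𝓘(ℝ, EM) L (hL.diffeo.symm p) = p := by
  rw [← hL.coe_diffeo, hL.diffeo.apply_symm_apply]

theorem IsHyperregular.hamiltonian_legendre (A : LieAlgebroid 𝓘(ℝ, EM) F V)
    (hL : IsHyperregular 𝓘(ℝ, EM) L) (a : TotalSpace F V) :
    hamiltonian A hL (legendre 𝓘(ℝ, EM) L a) = energy A L a := by
  rw [hamiltonian, Function.comp_apply, hL.symm_legendre]

theorem IsHyperregular.contMDiff_legendreSection (hL : IsHyperregular 𝓘(ℝ, EM) L)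
    {v : ∀ a : TotalSpace F V, V a.proj}
    (hv : ContMDiff (𝓘(ℝ, EM).prod 𝓘(ℝ, F)) (𝓘(ℝ, EM).prod 𝓘(ℝ, F)) ∞
      (fun a => (⟨a.proj, v a⟩ : TotalSpace F V))) :
    ContMDiff (𝓘(ℝ, EM).prod 𝓘(ℝ, F)) 𝓘(ℝ, ℝ) ∞
      (fun a => legendreSection (EM := EM) L a (v a)) :=
  contMDiff_dual_apply (M' := TotalSpace F V) (f := TotalSpace.proj)
    (φ := fun a => (legendre 𝓘(ℝ, EM) L a).snd) (v := v) hL.contMDiff hv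

theorem IsHyperregular.contMDiff_legendreSection_section (hL : IsHyperregular 𝓘(ℝ, EM) L)
    (X : Cₛ^∞⟮𝓘(ℝ, EM); F, V⟯) :
    ContMDiff (𝓘(ℝ, EM).prod 𝓘(ℝ, F)) 𝓘(ℝ, ℝ) ∞
      (fun a => legendreSection (EM := EM) L a (X a.proj)) :=
  hL.contMDiff_legendreSection (v := fun a => X a.proj) (X.contMDiff.comp (contMDiff_proj _))

theorem IsHyperregular.contMDiff_energy (A : LieAlgebroid 𝓘(ℝ, EM) F V)
    (hL : IsHyperregular 𝓘(ℝ, EM) L)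
    (hLs : ContMDiff (𝓘(ℝ, EM).prod 𝓘(ℝ, F)) 𝓘(ℝ, ℝ) ∞ L) :
    ContMDiff (𝓘(ℝ, EM).prod 𝓘(ℝ, F)) 𝓘(ℝ, ℝ) ∞ (energy A L) :=
  (hL.contMDiff_legendreSection (v := fun a => a.snd) contMDiff_id).sub hLs

theorem IsHyperregular.contMDiff_hamiltonian (A : LieAlgebroid 𝓘(ℝ, EM) F V)
    (hL : IsHyperregular 𝓘(ℝ, EM) L)
    (hLs : ContMDiff (𝓘(ℝ, EM).prod 𝓘(ℝ, F)) 𝓘(ℝ, ℝ) ∞ L) :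
    ContMDiff (𝓘(ℝ, EM).prod 𝓘(ℝ, F →L[ℝ] ℝ)) 𝓘(ℝ, ℝ) ∞ (hamiltonian A hL) :=
  (hL.contMDiff_energy A hLs).comp hL.diffeo.symm.contMDiff

/-- The function `a ↦ Leg_L(a)(B)` is the pullback by `Leg_L` of the function `p ↦ p(B)`. -/
theorem IsHyperregular.extDeriv_legendreSection (hL : IsHyperregular 𝓘(ℝ, EM) L)
    {a : TotalSpace F V} (Φ : FrameNear (EM := EM) F V a.proj) (b : V a.proj)
    (v : TangentSpace (𝓘(ℝ, EM).prod 𝓘(ℝ, F)) a) :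
    extDeriv (𝓘(ℝ, EM).prod 𝓘(ℝ, F)) (legendreSection (EM := EM) L) Φ b v =
      extDeriv (𝓘(ℝ, EM).prod 𝓘(ℝ, F →L[ℝ] ℝ)) (y := legendre 𝓘(ℝ, EM) L a) tautological Φ b
        (mfderiv (𝓘(ℝ, EM).prod 𝓘(ℝ, F)) (𝓘(ℝ, EM).prod 𝓘(ℝ, F →L[ℝ] ℝ))
          (legendre 𝓘(ℝ, EM) L) a v) := by
  refine (extDeriv_apply hL.contMDiff_legendreSection_section Φ b v).trans (Eq.trans ?_
    (extDeriv_apply (y := legendre 𝓘(ℝ, EM) L a) contMDiff_tautological Φ b _).symm)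
  exact dirDeriv_comp ((contMDiff_tautological (Φ.ext b)).mdifferentiable (by simp) _)
    (hL.mdifferentiable a) v

theorem prolLegendre_injective {A : LieAlgebroid 𝓘(ℝ, EM) F V}
    (hL : IsHyperregular 𝓘(ℝ, EM) L)
    (a : TotalSpace F V) : Function.Injective (prolLegendre A hL.mdifferentiable a) := by
  intro z z' h
  have h1 := congrArg Subtype.val h
  obtain ⟨h2, h3⟩ := Prod.mk_inj.1 h1
  exact Subtype.ext (Prod.ext h2 ((hL.mfderiv_bijective a).1 h3))

theorem prolLegendre_surjective {A : LieAlgebroid 𝓘(ℝ, EM) F V}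
    (hL : IsHyperregular 𝓘(ℝ, EM) L)
    (a : TotalSpace F V) : Function.Surjective (prolLegendre A hL.mdifferentiable a) := by
  rintro ⟨⟨b, w⟩, hz⟩
  obtain ⟨v, rfl⟩ := (hL.mfderiv_bijective a).2 w
  exact ⟨⟨(b, v), Eq.trans hz (mfderiv_proj_legendre (hL.mdifferentiable a) v)⟩, rfl⟩

theorem dFun_prolLegendre (A : LieAlgebroid 𝓘(ℝ, EM) F V)
    (hL : IsHyperregular 𝓘(ℝ, EM) L) (hLs : ContMDiff (𝓘(ℝ, EM).prod 𝓘(ℝ, F)) 𝓘(ℝ, ℝ) ∞ L)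
    (a : TotalSpace F V)
    (z : ProlFiber (𝓘(ℝ, EM).prod 𝓘(ℝ, F)) A TotalSpace.proj a) :
    dFun A TotalSpace.proj (hamiltonian A hL) (legendre 𝓘(ℝ, EM) L a)
      (prolLegendre A hL.mdifferentiable a z) = dFun A TotalSpace.proj (energy A L) a z := by
  have h1 : (fun a => hamiltonian A hL (legendre 𝓘(ℝ, EM) L a)) = energy A L :=
    funext (hL.hamiltonian_legendre A)
  have h2 := dirDeriv_comp (((hL.contMDiff_hamiltonian A hLs).mdifferentiable (by simp)) _)
    (hL.mdifferentiable a) z.1.2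
  rw [h1] at h2
  exact h2.symm

variable [FiniteDimensional ℝ EM] [T2Space M] [FiniteDimensional ℝ F]

theorem poincareCartanTwo_apply (A : LieAlgebroid 𝓘(ℝ, EM) F V) (hL : IsHyperregular 𝓘(ℝ, EM) L)
    (a : TotalSpace F V) (Φ : FrameNear (EM := EM) F V a.proj)
    (z z' : ProlFiber (𝓘(ℝ, EM).prod 𝓘(ℝ, F)) A TotalSpace.proj a) :
    poincareCartanTwo A L a z z' =
      -semibasicDiff A TotalSpace.proj (legendreSection (EM := EM) L) a Φ z z' := by
  rw [poincareCartanTwo, LinearMap.neg_apply, LinearMap.neg_apply]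
  change -dOne (semibasic A TotalSpace.proj (legendreSection (EM := EM) L)) a z z' = _
  rw [dOne_semibasic (contMDiff_proj _) hL.contMDiff_legendreSection_section
    (exists_prolSection_val_eq A)]

/-- The Legendre transformation pulls the canonical symplectic section back to the
Poincaré–Cartan 2-section. -/
theorem canonicalSymplectic_prolLegendre (A : LieAlgebroid 𝓘(ℝ, EM) F V)
    (hL : IsHyperregular 𝓘(ℝ, EM) L) (a : TotalSpace F V)
    (z z' : ProlFiber (𝓘(ℝ, EM).prod 𝓘(ℝ, F)) A TotalSpace.proj a) :
    canonicalSymplectic A (legendre 𝓘(ℝ, EM) L a) (prolLegendre A hL.mdifferentiable a z)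
      (prolLegendre A hL.mdifferentiable a z') = poincareCartanTwo A L a z z' := by
  obtain ⟨Φ⟩ := nonempty_frameNear (EM := EM) F V a.proj
  refine (canonicalSymplectic_apply A (legendre 𝓘(ℝ, EM) L a) Φ _ _).trans
    ((congrArg Neg.neg ?_).trans (poincareCartanTwo_apply A hL a Φ z z').symm)
  exact congrArg₂ (fun u v => u - v - legendreSection (EM := EM) L a
      (A.bracket (Φ.ext z.1.1) (Φ.ext z'.1.1) a.proj))
    (hL.extDeriv_legendreSection Φ z'.1.1 z.1.2).symm
    (hL.extDeriv_legendreSection Φ z.1.1 z'.1.2).symm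

/-- The Euler–Lagrange equation at `a` is the Hamilton equation at `Leg_L(a)`. -/
theorem poincareCartanTwo_eq_iff {A : LieAlgebroid 𝓘(ℝ, EM) F V}
    (hL : IsHyperregular 𝓘(ℝ, EM) L) (hLs : ContMDiff (𝓘(ℝ, EM).prod 𝓘(ℝ, F)) 𝓘(ℝ, ℝ) ∞ L)
    {a : TotalSpace F V}
    (z : ProlFiber (𝓘(ℝ, EM).prod 𝓘(ℝ, F)) A TotalSpace.proj a) :
    poincareCartanTwo A L a z = dFun A TotalSpace.proj (energy A L) a ↔
      canonicalSymplectic A (legendre 𝓘(ℝ, EM) L a) (prolLegendre A hL.mdifferentiable a z) =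
        dFun A TotalSpace.proj (hamiltonian A hL) (legendre 𝓘(ℝ, EM) L a) := by
  constructor
  · refine fun h => LinearMap.ext fun w => ?_
    obtain ⟨z', rfl⟩ := prolLegendre_surjective hL a w
    rw [canonicalSymplectic_prolLegendre A hL, h, dFun_prolLegendre A hL hLs]
  · refine fun h => LinearMap.ext fun z' => ?_
    rw [← canonicalSymplectic_prolLegendre A hL, h, dFun_prolLegendre A hL hLs]

theorem eq_zero_of_poincareCartanTwo_eq_zero {A : LieAlgebroid 𝓘(ℝ, EM) F V}
    (hL : IsHyperregular 𝓘(ℝ, EM) L) {a : TotalSpace F V}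
    {z : ProlFiber (𝓘(ℝ, EM).prod 𝓘(ℝ, F)) A TotalSpace.proj a}
    (h : poincareCartanTwo A L a z = 0) : z = 0 := by
  have h1 : prolLegendre A hL.mdifferentiable a z = 0 := by
    refine eq_zero_of_canonicalSymplectic_eq_zero (LinearMap.ext fun w => ?_)
    obtain ⟨z', rfl⟩ := prolLegendre_surjective hL a w
    rw [canonicalSymplectic_prolLegendre A hL, h]
    rfl
  have h2 : prolLegendre A hL.mdifferentiable a 0 = 0 :=
    Subtype.ext (Prod.ext rfl (ContinuousLinearMap.map_zero _))
  exact prolLegendre_injective hL a (h1.trans h2.symm)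

/-- A solution of `i_z ω_L = dE_L` at `a` has first component `a`: the Euler–Lagrange section is a
second order differential equation. -/
theorem fst_eq_of_poincareCartanTwo_eq {A : LieAlgebroid 𝓘(ℝ, EM) F V}
    (hL : IsHyperregular 𝓘(ℝ, EM) L) (hLs : ContMDiff (𝓘(ℝ, EM).prod 𝓘(ℝ, F)) 𝓘(ℝ, ℝ) ∞ L)
    {a : TotalSpace F V} {z : ProlFiber (𝓘(ℝ, EM).prod 𝓘(ℝ, F)) A TotalSpace.proj a}
    (h : poincareCartanTwo A L a z = dFun A TotalSpace.proj (energy A L) a) :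
    z.1.1 = a.snd := by
  obtain ⟨Φ⟩ := nonempty_frameNear (EM := EM) F V a.proj
  -- the derivative of `a ↦ Leg_L(a)(B)` along a vertical lift, `B` being an extension of `c`
  have hder : ∀ b c : V a.proj, HasDerivAt
      (fun t : ℝ => (legendre 𝓘(ℝ, EM) L ⟨a.proj, a.snd + t • b⟩).snd c)
      (extDeriv (𝓘(ℝ, EM).prod 𝓘(ℝ, F)) (legendreSection (EM := EM) L) Φ c
        (vertLift 𝓘(ℝ, EM) a b)) 0 := by
    intro b c
    rw [extDeriv_apply hL.contMDiff_legendreSection_section]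
    refine (hasDerivAt_vertLift ((hL.contMDiff_legendreSection_section
      (Φ.ext c)).mdifferentiable (by simp) a) b).congr_of_eventuallyEq
        (Eventually.of_forall fun t => ?_)
    change _ = (legendre 𝓘(ℝ, EM) L ⟨a.proj, a.snd + t • b⟩).snd (Φ.ext c a.proj)
    rw [Φ.ext_apply_self]
  -- Along `t ↦ a + t b` the energy is `Leg(a + t b)(a) + t Leg(a + t b)(b) - L(a + t b)`. At `t = 0`
  -- the derivatives of the last two terms cancel.
  have hE : ∀ b : V a.proj, dirDeriv (𝓘(ℝ, EM).prod 𝓘(ℝ, F)) (energy A L) a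
      (vertLift 𝓘(ℝ, EM) a b) = extDeriv (𝓘(ℝ, EM).prod 𝓘(ℝ, F))
        (legendreSection (EM := EM) L) Φ a.snd (vertLift 𝓘(ℝ, EM) a b) := by
    intro b
    have h1 := hasDerivAt_vertLift ((hL.contMDiff_energy A hLs).mdifferentiable (by simp) a) b
    have h2 := hasDerivAt_vertLift (hLs.mdifferentiable (by simp) a) b
    have h3 := ((hder b a.snd).add ((hasDerivAt_id (0 : ℝ)).mul (hder b b))).sub h2
    have h4 : (legendre 𝓘(ℝ, EM) L ⟨a.proj, a.snd + (0 : ℝ) • b⟩).snd b =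
        dirDeriv (𝓘(ℝ, EM).prod 𝓘(ℝ, F)) L a (vertLift 𝓘(ℝ, EM) a b) := by
      have key : ∀ w : V a.proj, w = a.snd → (legendre 𝓘(ℝ, EM) L ⟨a.proj, w⟩).snd b =
          dirDeriv (𝓘(ℝ, EM).prod 𝓘(ℝ, F)) L a (vertLift 𝓘(ℝ, EM) a b) := by
        rintro w rfl
        rfl
      exact key _ (by simp)
    rw [h4] at h3
    have h5 := h1.unique (h3.congr_of_eventuallyEq (Eventually.of_forall fun t => ?_))
    · rw [h5]
      simp
    · have h6 : ∀ φ : V a.proj →L[ℝ] ℝ, φ (a.snd + t • b) = φ a.snd + t * φ b := fun φ => by simp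
      exact congrArg (fun r => r - L ⟨a.proj, a.snd + t • b⟩)
        (h6 (legendre 𝓘(ℝ, EM) L ⟨a.proj, a.snd + t • b⟩).snd)
  have hv : ∀ b : V a.proj, extDeriv (𝓘(ℝ, EM).prod 𝓘(ℝ, F)) (legendreSection (EM := EM) L) Φ
      (z.1.1 - a.snd) (vertLift 𝓘(ℝ, EM) a b) = 0 := by
    intro b
    have h1 := LinearMap.congr_fun h ⟨(0, vertLift 𝓘(ℝ, EM) a b),
      (map_zero (A.anchor a.proj)).trans (mfderiv_proj_vertLift a b).symm⟩
    rw [poincareCartanTwo_apply A hL a Φ, semibasicDiff_apply] at h1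
    have h2 := h1.trans (hE b)
    rw [map_sub, LinearMap.sub_apply, ← h2]
    simp
  -- every vertical vector at `Leg_L(a)` is the image of a vertical vector at `a`
  refine sub_eq_zero.1 (eq_zero_of_forall_continuousDual
    ((trivializationAt F V a.proj).continuousLinearEquivAt ℝ a.proj
      (mem_baseSet_trivializationAt F V a.proj)) fun α => ?_)
  obtain ⟨w, hw⟩ := (hL.mfderiv_bijective a).2
    (vertLift 𝓘(ℝ, EM) (legendre 𝓘(ℝ, EM) L a) α)
  have hw0 := mfderiv_proj_legendre (hL.mdifferentiable a) w
  rw [hw] at hw0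
  obtain ⟨b, rfl⟩ := exists_vertLift_eq (hw0.symm.trans
    (mfderiv_proj_vertLift (legendre 𝓘(ℝ, EM) L a) α))
  have h1 := hL.extDeriv_legendreSection Φ (z.1.1 - a.snd) (vertLift 𝓘(ℝ, EM) a b)
  rw [hw, hv b] at h1
  exact (h1.trans (extDeriv_tautological_vertLift (p := legendre 𝓘(ℝ, EM) L a) Φ _ α)).symm

/-! ### Sections and curves that solve the equations -/

theorem existsUnique_eulerLagrangeSection (A : LieAlgebroid 𝓘(ℝ, EM) F V)
    (hL : IsHyperregular 𝓘(ℝ, EM) L)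
    (hLs : ContMDiff (𝓘(ℝ, EM).prod 𝓘(ℝ, F)) 𝓘(ℝ, ℝ) ∞ L) :
    ∃! ξ, IsEulerLagrangeSection A L ξ :=
  existsUnique_prolSection (fun _ _ => eq_zero_of_poincareCartanTwo_eq_zero hL)
    (fun X Y => (contMDiff_dOne_semibasic (contMDiff_proj _)
      hL.contMDiff_legendreSection_section X Y).neg)
    (fun X p => contMDiffAt_dirDeriv (f := id) (hL.contMDiff_energy A hLs) (X.contMDiff_snd p))

theorem existsUnique_hamiltonianSection (A : LieAlgebroid 𝓘(ℝ, EM) F V)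
    {H : TotalSpace (F →L[ℝ] ℝ) (fun x => V x →L[ℝ] ℝ) → ℝ}
    (hH : ContMDiff (𝓘(ℝ, EM).prod 𝓘(ℝ, F →L[ℝ] ℝ)) 𝓘(ℝ, ℝ) ∞ H) :
    ∃! ξ, IsHamiltonianSection A H ξ :=
  existsUnique_prolSection (fun _ _ => eq_zero_of_canonicalSymplectic_eq_zero)
    (fun X Y => (contMDiff_dOne_semibasic (contMDiff_proj _) contMDiff_tautological X Y).neg)
    (fun X p => contMDiffAt_dirDeriv (f := id) hH (X.contMDiff_snd p))

theorem eq_of_canonicalSymplectic_eq {A : LieAlgebroid 𝓘(ℝ, EM) F V}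
    {p : TotalSpace (F →L[ℝ] ℝ) (fun x => V x →L[ℝ] ℝ)}
    {z z' : ProlFiber (𝓘(ℝ, EM).prod 𝓘(ℝ, F →L[ℝ] ℝ)) A TotalSpace.proj p}
    (h : canonicalSymplectic A p z = canonicalSymplectic A p z') : z = z' :=
  sub_eq_zero.1 (eq_zero_of_canonicalSymplectic_eq_zero (by rw [map_sub, h, sub_self]))

theorem hamiltonianSection_legendre {A : LieAlgebroid 𝓘(ℝ, EM) F V}
    (hL : IsHyperregular 𝓘(ℝ, EM) L) (hLs : ContMDiff (𝓘(ℝ, EM).prod 𝓘(ℝ, F)) 𝓘(ℝ, ℝ) ∞ L)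
    {ξL : ProlSection (𝓘(ℝ, EM).prod 𝓘(ℝ, F)) A (TotalSpace.proj : TotalSpace F V → M)}
    {ξH : ProlSection (𝓘(ℝ, EM).prod 𝓘(ℝ, F →L[ℝ] ℝ)) A
      (TotalSpace.proj : TotalSpace (F →L[ℝ] ℝ) (fun x => V x →L[ℝ] ℝ) → M)}
    (hξL : IsEulerLagrangeSection A L ξL) (hξH : IsHamiltonianSection A (hamiltonian A hL) ξH)
    (a : TotalSpace F V) :
    ξH.val (legendre 𝓘(ℝ, EM) L a) = prolLegendre A hL.mdifferentiable a (ξL.val a) :=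
  eq_of_canonicalSymplectic_eq
    ((hξH _).trans ((poincareCartanTwo_eq_iff hL hLs _).1 (hξL a)).symm)

/-- The Legendre transformation maps the solutions of the Euler–Lagrange equations to those of the
Hamilton equations, and only them. -/
theorem isHamiltonSolution_legendre_comp_iff {A : LieAlgebroid 𝓘(ℝ, EM) F V}
    (hL : IsHyperregular 𝓘(ℝ, EM) L) (hLs : ContMDiff (𝓘(ℝ, EM).prod 𝓘(ℝ, F)) 𝓘(ℝ, ℝ) ∞ L)
    {γ : ℝ → TotalSpace F V} {s : Set ℝ} (hs : IsOpen s) :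
    IsHamiltonSolution A (hamiltonian A hL) (legendre 𝓘(ℝ, EM) L ∘ γ) s ↔
      IsEulerLagrangeSolution A L γ s := by
  have hγ : ContMDiffOn 𝓘(ℝ, ℝ) (𝓘(ℝ, EM).prod 𝓘(ℝ, F →L[ℝ] ℝ)) ∞
      (legendre 𝓘(ℝ, EM) L ∘ γ) s ↔ ContMDiffOn 𝓘(ℝ, ℝ) (𝓘(ℝ, EM).prod 𝓘(ℝ, F)) ∞ γ s := by
    refine ⟨fun h => ?_, fun h => hL.contMDiff.comp_contMDiffOn h⟩
    have h1 := hL.diffeo.symm.contMDiff.comp_contMDiffOn h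
    exact h1.congr fun t _ => (hL.symm_legendre (γ t)).symm
  have hder : ContMDiffOn 𝓘(ℝ, ℝ) (𝓘(ℝ, EM).prod 𝓘(ℝ, F)) ∞ γ s → ∀ t ∈ s,
      mfderiv 𝓘(ℝ, ℝ) (𝓘(ℝ, EM).prod 𝓘(ℝ, F →L[ℝ] ℝ)) (legendre 𝓘(ℝ, EM) L ∘ γ) t (1 : ℝ) =
        mfderiv (𝓘(ℝ, EM).prod 𝓘(ℝ, F)) (𝓘(ℝ, EM).prod 𝓘(ℝ, F →L[ℝ] ℝ)) (legendre 𝓘(ℝ, EM) L)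
          (γ t) (mfderiv 𝓘(ℝ, ℝ) (𝓘(ℝ, EM).prod 𝓘(ℝ, F)) γ t (1 : ℝ)) := by
    intro h t ht
    have h1 : MDifferentiableAt 𝓘(ℝ, ℝ) (𝓘(ℝ, EM).prod 𝓘(ℝ, F)) γ t :=
      (h.contMDiffAt (hs.mem_nhds ht)).mdifferentiableAt (by simp)
    exact DFunLike.congr_fun (mfderiv_comp t (hL.mdifferentiable _) h1) (1 : ℝ)
  obtain ⟨ξL, hξL, -⟩ := existsUnique_eulerLagrangeSection A hL hLs
  constructor
  · rintro ⟨h1, ξ, hξ, h2⟩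
    refine ⟨hγ.1 h1, fun t ht => ?_⟩
    have h3 := hamiltonianSection_legendre hL hLs hξL hξ (γ t)
    have h4 : ξL.snd (γ t) = mfderiv 𝓘(ℝ, ℝ) (𝓘(ℝ, EM).prod 𝓘(ℝ, F)) γ t (1 : ℝ) := by
      refine (hL.mfderiv_bijective (γ t)).1 ?_
      rw [← hder (hγ.1 h1) t ht, h2 t ht]
      exact (congrArg (fun z => z.1.2) h3).symm
    -- admissibility of the velocity is the second order property of `ξL`
    have h5 : ξL.fst (γ t) = (γ t).snd := fst_eq_of_poincareCartanTwo_eq hL hLs (hξL (γ t))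
    rw [← h4, ← h5]
    exact ⟨(ξL.val (γ t)).2, hξL (γ t)⟩
  · rintro ⟨h1, h2⟩
    obtain ⟨ξ, hξ, -⟩ := existsUnique_hamiltonianSection A (hL.contMDiff_hamiltonian A hLs)
    refine ⟨hγ.2 h1, ξ, hξ, fun t ht => ?_⟩
    obtain ⟨hz, h3⟩ := h2 t ht
    have h4 := (poincareCartanTwo_eq_iff hL hLs _).1 h3
    have h5 := eq_of_canonicalSymplectic_eq (h4.trans (hξ _).symm)
    rw [hder h1 t ht]
    exact congrArg (fun z => z.1.2) h5

end Legendre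

end LieAlgebroidMechanics

end

theorem theorem3p4
    {EM : Type*} [NormedAddCommGroup EM] [NormedSpace ℝ EM] [FiniteDimensional ℝ EM]
    {M : Type*} [TopologicalSpace M] [T2Space M] [ParacompactSpace M]
    [ChartedSpace EM M] [IsManifold 𝓘(ℝ, EM) ∞ M]
    {F : Type*} [NormedAddCommGroup F] [NormedSpace ℝ F] [FiniteDimensional ℝ F]
    {V : M → Type*} [TopologicalSpace (TotalSpace F V)]
    [∀ x, AddCommGroup (V x)] [∀ x, Module ℝ (V x)] [∀ x, TopologicalSpace (V x)]
    [FiberBundle F V] [VectorBundle ℝ F V] [ContMDiffVectorBundle ∞ F V 𝓘(ℝ, EM)]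
    (A : LieAlgebroidMechanics.LieAlgebroid 𝓘(ℝ, EM) F V)
    (L : TotalSpace F V → ℝ)
    (hLsmooth : ContMDiff (𝓘(ℝ, EM).prod 𝓘(ℝ, F)) 𝓘(ℝ, ℝ) ∞ L)
    (hL : LieAlgebroidMechanics.IsHyperregular 𝓘(ℝ, EM) L) :
    (∃! ξL, LieAlgebroidMechanics.IsEulerLagrangeSection A L ξL) ∧
    (∃! ξH, LieAlgebroidMechanics.IsHamiltonianSection A
      (LieAlgebroidMechanics.hamiltonian A hL) ξH) ∧
    (∀ ξL ξH, LieAlgebroidMechanics.IsEulerLagrangeSection A L ξL →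
      LieAlgebroidMechanics.IsHamiltonianSection A
        (LieAlgebroidMechanics.hamiltonian A hL) ξH →
      ∀ a : TotalSpace F V,
        ξH.val (LieAlgebroidMechanics.legendre 𝓘(ℝ, EM) L a) =
          LieAlgebroidMechanics.prolLegendre A hL.mdifferentiable a (ξL.val a)) ∧
    (∀ s : Set ℝ, IsOpen s → s.OrdConnected →
      (∀ γ : ℝ → TotalSpace F V,
        LieAlgebroidMechanics.IsEulerLagrangeSolution A L γ s →
        LieAlgebroidMechanics.IsHamiltonSolution A (LieAlgebroidMechanics.hamiltonian A hL)
          (LieAlgebroidMechanics.legendre 𝓘(ℝ, EM) L ∘ γ) s) ∧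
      (∀ μ : ℝ → TotalSpace (F →L[ℝ] ℝ) (fun x => V x →L[ℝ] ℝ),
        LieAlgebroidMechanics.IsHamiltonSolution A (LieAlgebroidMechanics.hamiltonian A hL) μ s →
        LieAlgebroidMechanics.IsEulerLagrangeSolution A L (hL.diffeo.symm ∘ μ) s) ∧
      Set.BijOn (fun γ : ℝ → TotalSpace F V => LieAlgebroidMechanics.legendre 𝓘(ℝ, EM) L ∘ γ)
        {γ | LieAlgebroidMechanics.IsEulerLagrangeSolution A L γ s}
        {μ | LieAlgebroidMechanics.IsHamiltonSolution A
          (LieAlgebroidMechanics.hamiltonian A hL) μ s}) := by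
  open LieAlgebroidMechanics in
  have hsymm : ∀ μ : ℝ → TotalSpace (F →L[ℝ] ℝ) (fun x => V x →L[ℝ] ℝ),
      legendre 𝓘(ℝ, EM) L ∘ (hL.diffeo.symm ∘ μ) = μ := fun μ =>
    funext fun t => hL.legendre_symm (μ t)
  have hmaps : ∀ s : Set ℝ, IsOpen s → ∀ μ : ℝ → TotalSpace (F →L[ℝ] ℝ) (fun x => V x →L[ℝ] ℝ),
      IsHamiltonSolution A (hamiltonian A hL) μ s →
        IsEulerLagrangeSolution A L (hL.diffeo.symm ∘ μ) s := fun s hs μ hμ => by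
    rw [← isHamiltonSolution_legendre_comp_iff hL hLsmooth hs, hsymm]
    exact hμ
  exact ⟨existsUnique_eulerLagrangeSection A hL hLsmooth,
    existsUnique_hamiltonianSection A (hL.contMDiff_hamiltonian A hLsmooth),
    fun ξL ξH hξL hξH => hamiltonianSection_legendre hL hLsmooth hξL hξH,
    fun s hs _ => ⟨fun γ => (isHamiltonSolution_legendre_comp_iff hL hLsmooth hs).2,
      hmaps s hs,
      fun γ => (isHamiltonSolution_legendre_comp_iff hL hLsmooth hs).2,
      fun γ _ γ' _ h => (hL.coe_diffeo ▸ hL.diffeo.injective : Function.Injective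
        (legendre 𝓘(ℝ, EM) L)).comp_left h,
      fun μ hμ => ⟨_, hmaps s hs μ hμ, hsymm μ⟩⟩⟩
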